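/- Let $\Theta\subseteq\mathbb{R}^d$ be open and connected, $N\ge 1$, and let $f_i=f(x_i;\cdot):\Theta\to[\widetilde F_{\min},\widetilde F_{\max}]$, $i\in[N]$, be differentiable and $L$-Lipschitz. Let $t>0$, $\Delta:=\widetilde F_{\max}-\widetilde F_{\min}$, and let $$\widetilde R(t;\theta):=\tfrac1t\log\Big(\tfrac1N\sum_{i\in[N]}e^{tf_i(\theta)}\Big)$$ be the $t$-tilted empirical risk, with $\breve\theta(t)\in\arg\min_{\theta\in\Theta}\widetilde R(t;\theta)$ (assumed to exist). Assume that $\widetilde R(t;\cdot)$ is $\beta$-smooth on $\Theta$ (its gradient is $\beta$-Lipschitz) and that $\big\|e^{t(f_i(\theta)-\widetilde R(t;\theta))}\nabla f_i(\theta)\big\|\le B$ for all $\theta\in\Theta$, $i\in[N]$. Assume further that there is $\mu>0$ such that for every $\mathbf p$ in the probability simplex $\Delta_N$ the function $g=\sum_i p_if_i$ is $\frac\mu2$-PL on $\Theta$, i.e. $\frac\mu2\,(g(\theta)-\inf_\Theta g)\le\frac12\|\nabla g(\theta)\|^2$ for all $\theta\in\Theta$. Let $k_t$ be the largest integer $k\ge1$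 with $$k<\frac{4e}{\mu}+\frac{4e\,tLB\,e^{t\Delta}}{\mu k}$$ ($k_t:=0$ if there is none), and put $\lambda=1-\frac1{2e}$, $\alpha_k=\frac{1}{tLBe^{t\Delta}+1}$ for $k<k_t$ and $\alpha_k=\frac{4e}{\mu k}$ for $k\ge k_t$. Let $\zeta_1,\xi_1,\zeta_2,\xi_2,\dots$ be independent and uniformly distributed on $[N]$. The stochastic TERM solver with two independent mini-batches of size 1 starts at a given $\theta_1\in\Theta$ with $r_0=\widetilde R(t;\theta_1)$, and for $k=1,2,\dots$ sets $$r_k=\tfrac1t\log\big((1-\lambda)e^{tr_{k-1}}+\lambda e^{tf_{\xi_k}(\theta_k)}\big),\qquad \theta_{k+1}=\theta_k-\alpha_k\,e^{t(f_{\zeta_k}(\theta_k)-r_k)}\,\nabla f_{\zeta_k}(\theta_k).$$ Assume that almost surely the run stays in $\Theta$, i.e. each segment $[\theta_k,\theta_{k+1}]$ lies in $\Theta$ (for convex $\Theta$: each $\theta_k$ does). Then $\widetilde R(t;\theta_k)$ is integrable for every $k$, and for all $k\ge k_t$ $$\mathbb E\big[\widetilde R(t;\theta_{k+1})-\widetilde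 R(t;\breve\theta(t))\big]\le\frac{V_t}{k+1},\qquad V_t=\max\Big\{k_t\,\mathbb E\big[\widetilde R(t;\theta_{k_t})-\widetilde R(t;\breve\theta(t))\big],\ \frac{8\beta B^2e^{2t\Delta+2}}{\mu^2}\Big\}.$$ -/

import Mathlib

open MeasureTheory ProbabilityTheory
open scoped NNReal

namespace TERM

noncomputable section

/-- The `t`-tilted empirical risk `(1/t) log ((1/N) ∑ i, exp (t f_i(θ)))` of the sample losses
`f 0, …, f (N-1)`, where `f i = f(x_i; ·)`. -/
def tiltedRisk {d N : ℕ} (f : Fin N → EuclideanSpace ℝ (Fin d) → ℝ) (t : ℝ)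
    (θ : EuclideanSpace ℝ (Fin d)) : ℝ :=
  (1 / t) * Real.log ((1 / (N : ℝ)) * ∑ i, Real.exp (t * f i θ))

/-- The stochastic gradient of the tilted risk at sample `i`:
`(exp (t f_i(θ)) / exp (t R(t;θ))) ∇f_i(θ)`. -/
def tiltedStochGrad {d N : ℕ} (f : Fin N → EuclideanSpace ℝ (Fin d) → ℝ) (t : ℝ) (i : Fin N)
    (θ : EuclideanSpace ℝ (Fin d)) : EuclideanSpace ℝ (Fin d) :=
  (Real.exp (t * f i θ) / Real.exp (t * tiltedRisk f t θ)) • gradient (f i) θ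

/-- `g` is `β`-smooth on `Θ`: differentiable there with `β`-Lipschitz gradient. -/
def IsSmoothOn {d : ℕ} (β : ℝ≥0) (g : EuclideanSpace ℝ (Fin d) → ℝ)
    (Θ : Set (EuclideanSpace ℝ (Fin d))) : Prop :=
  DifferentiableOn ℝ g Θ ∧ LipschitzOnWith β (gradient g) Θ

/-- The Polyak-Łojasiewicz condition on `Θ` with constant `m`:
`m (g(θ) - inf_Θ g) ≤ ‖∇g(θ)‖² / 2` on `Θ`. The infimum is spelled out as a universally
quantified competitor `θ'`. -/
def IsPLOn {d : ℕ} (m : ℝ) (g : EuclideanSpace ℝ (Fin d) → ℝ)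
    (Θ : Set (EuclideanSpace ℝ (Fin d))) : Prop :=
  ∀ θ ∈ Θ, ∀ θ' ∈ Θ, m * (g θ - g θ') ≤ (1 / 2) * ‖gradient g θ‖ ^ 2

/-- One pass of the two-mini-batch stochastic TERM loop with batch size 1, from the state
`(θ, estimate of the tilted risk)`. The sample `j` updates the estimate (the tilted loss on the
one-element batch `{j}` is `f j θ`), then the sample `i` and the updated estimate give the weight
and the gradient of the step on `θ`. -/
def step {d N : ℕ} (f : Fin N → EuclideanSpace ℝ (Fin d) → ℝ) (t lam α : ℝ) (i j : Fin N)
    (s : EuclideanSpace ℝ (Fin d) × ℝ) : EuclideanSpace ℝ (Fin d) × ℝ :=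
  let r : ℝ :=
    (1 / t) * Real.log ((1 - lam) * Real.exp (t * s.2) + lam * Real.exp (t * f j s.1))
  (s.1 - α • (Real.exp (t * f i s.1 - t * r) • gradient (f i) s.1), r)

/-- The state after `n` passes of the loop, started at `θ₁` with the exact tilted risk as estimate.
Pass number `k = 1, 2, …` uses the step size `α k` and the samples `ζ k` (gradient) and
`ξ k` (estimate). -/
def run {d N : ℕ} (f : Fin N → EuclideanSpace ℝ (Fin d) → ℝ) (t lam : ℝ) (α : ℕ → ℝ)
    (θ₁ : EuclideanSpace ℝ (Fin d)) (ζ ξ : ℕ → Fin N) : ℕ → EuclideanSpace ℝ (Fin d) × ℝ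
  | 0 => (θ₁, tiltedRisk f t θ₁)
  | n + 1 => step f t lam (α (n + 1)) (ζ (n + 1)) (ξ (n + 1)) (run f t lam α θ₁ ζ ξ n)

/-- The `k`-th iterate `θ_k`, for `k = 1, 2, …`: the parameter after `k - 1` passes, so that
`θ_{k+1}` is obtained from `θ_k` in pass `k`. (The unused index `0` also gives `θ₁`.) -/
def iterate {d N : ℕ} (f : Fin N → EuclideanSpace ℝ (Fin d) → ℝ) (t lam : ℝ) (α : ℕ → ℝ)
    (θ₁ : EuclideanSpace ℝ (Fin d)) (ζ ξ : ℕ → Fin N) (k : ℕ) : EuclideanSpace ℝ (Fin d) :=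
  (run f t lam α θ₁ ζ ξ (k - 1)).1

/-- The burn-in `k_t`: the largest integer `k ≥ 1` with
`k < 4e/μ + 4e t L B exp (t (Fmax - Fmin)) / (μ k)`, and `0` if there is none. -/
def burnIn (t μ L B Fmin Fmax : ℝ) : ℕ :=
  sSup {k : ℕ | 1 ≤ k ∧ (k : ℝ) < 4 * Real.exp 1 / μ +
    4 * Real.exp 1 * t * L * B * Real.exp (t * (Fmax - Fmin)) / (μ * k)}

/-- The averaging weight `λ = 1 - 1/(2e)` of the solver. -/
def avgWeight : ℝ := 1 - 1 / (2 * Real.exp 1)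

/-- The step sizes of the solver: constant during the burn-in, then `4e/(μ k)`. -/
def stepSize (t μ L B Fmin Fmax : ℝ) (k : ℕ) : ℝ :=
  if k < burnIn t μ L B Fmin Fmax then
    1 / (t * L * B * Real.exp (t * (Fmax - Fmin)) + 1)
  else 4 * Real.exp 1 / (μ * k)

/-- The (random) iterates `θ_k` of the solver with its parameters inserted. -/
def solver {Ω : Type*} {d N : ℕ} (f : Fin N → EuclideanSpace ℝ (Fin d) → ℝ)
    (t μ L B Fmin Fmax : ℝ) (θ₁ : EuclideanSpace ℝ (Fin d)) (ζ ξ : ℕ → Ω → Fin N)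
    (k : ℕ) (ω : Ω) : EuclideanSpace ℝ (Fin d) :=
  iterate f t avgWeight (stepSize t μ L B Fmin Fmax) θ₁ (fun n => ζ n ω) (fun n => ξ n ω) k

end

end TERM

/-!
By Jensen's inequality for `exp`, the tilted risk inherits the Polyak-Łojasiewicz inequality from
the mixtures of the losses, with the mixture weights `exp (t f_i(θ)) / ∑ j, exp (t f_j(θ))`. The
solver follows a stochastic gradient of the tilted risk whose length is off by the factor `u⁻¹`,
where `u = exp (t (r_k - R(t; θ_k)))` measures the error of the current estimate. Since `u` and the
suboptimality `D_k` are dependent, one step of descent involves the correlation of `u⁻¹` and the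
suboptimality. It is bounded below through `u⁻¹ ≥ 1 - u / 4`: as an average over the new sample, `u`
forgets its past at rate `1 - λ = 1 / (2e)` and gains at most a factor `e` from the drift of
`R(t; θ_k)` once the steps are small, so the correlation of `u` and the suboptimality is at most
`2 D_k` up to the noise level. As long as the steps are large, `D_k` is below the noise level
anyway. If `2β < μ`, the tilted risk is constant on `Θ`.
-/

namespace TERM

open scoped BigOperators

section Gradient

variable {E : Type*} [NormedAddCommGroup E] [InnerProductSpace ℝ E] [CompleteSpace E]
  {g : E → ℝ} {Θ : Set E} {x y m : E}

theorem hasDerivAt_comp_add_smul {v : E} {s : ℝ} (hg : DifferentiableAt ℝ g (x + s • v)) :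
    HasDerivAt (fun s : ℝ => g (x + s • v)) (inner ℝ (gradient g (x + s • v)) v) s := by
  have hline : HasDerivAt (fun s : ℝ => x + s • v) v s := by
    simpa using ((hasDerivAt_id s).smul_const v).const_add x
  exact hg.hasGradientAt.hasFDerivAt.comp_hasDerivAt s hline

theorem le_quadratic_of_lipschitzOnWith_gradient {β : ℝ≥0}
    (hg : ∀ z ∈ segment ℝ x y, DifferentiableAt ℝ g z)
    (hβ : LipschitzOnWith β (gradient g) (segment ℝ x y)) :
    g y ≤ g x + inner ℝ (gradient g x) (y - x) + β / 2 * ‖y - x‖ ^ 2 := by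
  have hmem : ∀ s ∈ Set.Icc (0 : ℝ) 1, x + s • (y - x) ∈ segment ℝ x y := fun s hs => by
    rw [segment_eq_image']; exact ⟨s, hs, rfl⟩
  have hderiv := fun s hs => hasDerivAt_comp_add_smul (hg _ (hmem s hs))
  have hderiv_quadratic (s : ℝ) : HasDerivAt
      (fun s => g x + s * inner ℝ (gradient g x) (y - x) + s ^ 2 * (β / 2 * ‖y - x‖ ^ 2))
      (inner ℝ (gradient g x) (y - x) + s * (β * ‖y - x‖ ^ 2)) s := by
    refine ((((hasDerivAt_id s).mul_const _).const_add _).add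
      ((hasDerivAt_pow 2 s).mul_const _)).congr_deriv ?_
    simp only [Nat.cast_ofNat, Nat.add_one_sub_one, pow_one]
    ring
  have hbound : ∀ s ∈ Set.Ico (0 : ℝ) 1, inner ℝ (gradient g (x + s • (y - x))) (y - x)
      ≤ inner ℝ (gradient g x) (y - x) + s * (β * ‖y - x‖ ^ 2) := fun s hs => by
    rw [← sub_le_iff_le_add', ← inner_sub_left]
    calc inner ℝ (gradient g (x + s • (y - x)) - gradient g x) (y - x)
        ≤ ‖gradient g (x + s • (y - x)) - gradient g x‖ * ‖y - x‖ := real_inner_le_norm _ _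
      _ ≤ β * ‖x + s • (y - x) - x‖ * ‖y - x‖ := by
          gcongr
          exact hβ.norm_sub_le (hmem s (Set.Ico_subset_Icc_self hs)) (left_mem_segment ℝ x y)
      _ = s * (β * ‖y - x‖ ^ 2) := by
          rw [add_sub_cancel_left, norm_smul, Real.norm_of_nonneg hs.1]; ring
  have h := image_le_of_deriv_right_le_deriv_boundary
    (fun s hs => (hderiv s hs).continuousAt.continuousWithinAt)
    (fun s hs => (hderiv s (Set.Ico_subset_Icc_self hs)).hasDerivWithinAt) (by simp)
    (fun s _ => (hderiv_quadratic s).continuousAt.continuousWithinAt)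
    (fun s _ => (hderiv_quadratic s).hasDerivWithinAt) hbound (Set.right_mem_Icc.2 zero_le_one)
  simpa using h

theorem abs_sub_le_of_norm_gradient_le {C : ℝ}
    (hg : ∀ z ∈ segment ℝ x y, DifferentiableAt ℝ g z)
    (hC : ∀ z ∈ segment ℝ x y, ‖gradient g z‖ ≤ C) : |g y - g x| ≤ C * ‖y - x‖ := by
  refine (convex_segment x y).norm_image_sub_le_of_norm_fderiv_le (𝕜 := ℝ) hg (fun z hz => ?_)
    (left_mem_segment ℝ x y) (right_mem_segment ℝ x y)
  simpa only [gradient, LinearIsometryEquiv.norm_map] using hC z hz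

/- From `x` close to the minimizer `m`, the gradient step of length `2 / μ` stays in the domain and
decreases `g` by more than the Polyak-Łojasiewicz inequality allows, unless `g x = g m`. -/
theorem eventually_eq_of_lipschitz_gradient_lt_PL {β : ℝ≥0} {μ : ℝ} (hΘ : IsOpen Θ)
    (hg : DifferentiableOn ℝ g Θ) (hβ : LipschitzOnWith β (gradient g) Θ) (hm : m ∈ Θ)
    (hmin : IsMinOn g Θ m) (hμ : 2 * β < μ)
    (hPL : ∀ x ∈ Θ, μ * (g x - g m) ≤ ‖gradient g x‖ ^ 2) : ∀ᶠ x in nhds m, g x = g m := by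
  have hμ_pos : 0 < μ := lt_of_le_of_lt (by positivity) hμ
  obtain ⟨ε, hε, hball⟩ := Metric.isOpen_iff.1 hΘ m hm
  have hgrad : gradient g m = 0 := by
    rw [gradient, (hmin.isLocalMin (hΘ.mem_nhds hm)).fderiv_eq_zero, map_zero]
  filter_upwards [Metric.ball_mem_nhds m (half_pos hε)] with x hx
  have hxΘ : x ∈ Θ := hball (Metric.ball_subset_ball (half_le_self hε.le) hx)
  set v := gradient g x with hv
  have hstep : ‖(2 / μ) • v‖ ≤ ‖x - m‖ := by
    have hlip : ‖v‖ ≤ β * ‖x - m‖ := by simpa [hgrad] using hβ.norm_sub_le hxΘ hm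
    rw [norm_smul, Real.norm_of_nonneg (by positivity), div_mul_eq_mul_div, div_le_iff₀ hμ_pos]
    nlinarith [norm_nonneg (x - m)]
  have hy : x - (2 / μ) • v ∈ Metric.ball m ε := by
    rw [Metric.mem_ball, dist_eq_norm] at hx ⊢
    rw [sub_right_comm]
    linarith [norm_sub_le (x - m) ((2 / μ) • v)]
  have hseg : segment ℝ x (x - (2 / μ) • v) ⊆ Θ :=
    ((convex_ball m ε).segment_subset
      (Metric.ball_subset_ball (half_le_self hε.le) hx) hy).trans hball
  have hdescent := le_quadratic_of_lipschitzOnWith_gradient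
    (fun z hz => hg.differentiableAt (hΘ.mem_nhds (hseg hz))) (hβ.mono hseg)
  rw [sub_sub_cancel_left, inner_neg_right, inner_smul_right, ← hv, real_inner_self_eq_norm_sq,
    norm_neg, norm_smul, Real.norm_of_nonneg (by positivity)] at hdescent
  have hdecrease : 2 * (1 - β / μ) * ‖v‖ ^ 2 ≤ μ * (g x - g m) := by
    have h : g m ≤ g (x - (2 / μ) • v) := hmin (hball hy)
    calc 2 * (1 - β / μ) * ‖v‖ ^ 2
        = μ * (2 / μ * ‖v‖ ^ 2 - β / 2 * (2 / μ * ‖v‖) ^ 2) := by field_simp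
      _ ≤ μ * (g x - g m) := mul_le_mul_of_nonneg_left (by linarith) hμ_pos.le
  have hβμ : 2 * (β / μ) < 1 := by rw [← mul_div_assoc, div_lt_one hμ_pos]; exact hμ
  have hv_sq : ‖v‖ ^ 2 ≤ 0 := by nlinarith [hPL x hxΘ]
  have hle : g x - g m ≤ 0 := by nlinarith [hPL x hxΘ]
  exact le_antisymm (by linarith) (hmin hxΘ)

theorem eq_of_lipschitz_gradient_lt_PL {β : ℝ≥0} {μ : ℝ} (hΘ : IsOpen Θ)
    (hconn : IsPreconnected Θ) (hg : DifferentiableOn ℝ g Θ)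
    (hβ : LipschitzOnWith β (gradient g) Θ) (hm : m ∈ Θ) (hmin : IsMinOn g Θ m) (hμ : 2 * β < μ)
    (hPL : ∀ x ∈ Θ, μ * (g x - g m) ≤ ‖gradient g x‖ ^ 2) (hx : x ∈ Θ) : g x = g m := by
  have hlocal : ∀ z ∈ Θ, g z = g m → ∀ᶠ x in nhds z, g x = g m := fun z hz hzm => by
    rw [← hzm] at hPL ⊢
    exact eventually_eq_of_lipschitz_gradient_lt_PL hΘ hg hβ hz
      (fun x hx => hzm.le.trans (hmin hx)) hμ hPL
  have hsub : Θ ⊆ interior {z | g z = g m} := by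
    refine hconn.subset_of_closure_inter_subset isOpen_interior
      ⟨m, hm, mem_interior_iff_mem_nhds.2 (hlocal m hm rfl)⟩ fun z ⟨hz, hzΘ⟩ => ?_
    refine mem_interior_iff_mem_nhds.2 (hlocal z hzΘ ?_)
    have hfreq : ∃ᶠ x in nhds z, g x = g m :=
      (mem_closure_iff_frequently.1 hz).mono fun x hx => interior_subset (s := {z | g z = g m}) hx
    by_contra hne
    exact hfreq ((hg.differentiableAt (hΘ.mem_nhds hzΘ)).continuousAt.eventually_ne hne)
  exact interior_subset (s := {z | g z = g m}) (hsub hx)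

theorem hasGradientAt_sum_mul {ι : Type*} [Fintype ι] {f : ι → E → ℝ}
    (hf : ∀ i, DifferentiableAt ℝ (f i) x) (p : ι → ℝ) :
    HasGradientAt (fun y => ∑ i, p i * f i y) (∑ i, p i • gradient (f i) x) x := by
  rw [hasGradientAt_iff_hasFDerivAt, map_sum]
  refine HasFDerivAt.fun_sum fun i _ => ?_
  simpa using (hf i).hasGradientAt.hasFDerivAt.const_mul (p i)

end Gradient

section TiltedRisk

variable {d N : ℕ} {f : Fin N → EuclideanSpace ℝ (Fin d) → ℝ} {t : ℝ}
  {θ θ' : EuclideanSpace ℝ (Fin d)} {Θ : Set (EuclideanSpace ℝ (Fin d))}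

/-- The probability `exp (t f_i(θ)) / ∑ j, exp (t f_j(θ))` that the tilting puts on the sample `i`,
written with the tilted risk as normalization. -/
noncomputable def tiltWeight (f : Fin N → EuclideanSpace ℝ (Fin d) → ℝ) (t : ℝ)
    (θ : EuclideanSpace ℝ (Fin d)) (i : Fin N) : ℝ :=
  Real.exp (t * f i θ) / Real.exp (t * tiltedRisk f t θ) / N

theorem sum_tiltWeight_mul (x : Fin N → ℝ) :
    ∑ i, tiltWeight f t θ i * x i
      = 𝔼 i, Real.exp (t * f i θ) / Real.exp (t * tiltedRisk f t θ) * x i := by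
  rw [Fintype.expect_eq_sum_div_card, Fintype.card_fin, Finset.sum_div]
  exact Finset.sum_congr rfl fun i _ => div_mul_eq_mul_div _ _ _

variable [NeZero N]

theorem exp_mul_tiltedRisk (ht : t ≠ 0) (θ : EuclideanSpace ℝ (Fin d)) :
    Real.exp (t * tiltedRisk f t θ) = 𝔼 i, Real.exp (t * f i θ) := by
  have hpos : 0 < 𝔼 i, Real.exp (t * f i θ) :=
    Finset.expect_pos (fun i _ => Real.exp_pos _) Finset.univ_nonempty
  rw [Fintype.expect_eq_sum_div_card, Fintype.card_fin, div_eq_inv_mul, ← one_div] at hpos ⊢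
  rw [tiltedRisk, ← mul_assoc, mul_one_div_cancel ht, one_mul, Real.exp_log hpos]

theorem tiltedRisk_mem_Icc (ht : 0 < t) {a b : ℝ} (h : ∀ i, f i θ ∈ Set.Icc a b) :
    tiltedRisk f t θ ∈ Set.Icc a b := by
  refine ⟨le_of_mul_le_mul_left (Real.exp_le_exp.1 ?_) ht,
    le_of_mul_le_mul_left (Real.exp_le_exp.1 ?_) ht⟩ <;> rw [exp_mul_tiltedRisk ht.ne']
  · exact Finset.le_expect Finset.univ_nonempty fun i _ => by gcongr; exact (h i).1
  · exact Finset.expect_le Finset.univ_nonempty fun i _ => by gcongr; exact (h i).2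

theorem tiltWeight_mem_stdSimplex (ht : t ≠ 0) : tiltWeight f t θ ∈ stdSimplex ℝ (Fin N) := by
  refine ⟨fun i => by unfold tiltWeight; positivity, ?_⟩
  have h := sum_tiltWeight_mul (f := f) (t := t) (θ := θ) 1
  simp only [Pi.one_apply, mul_one] at h
  rw [h, ← Finset.expect_div, ← exp_mul_tiltedRisk ht, div_self (Real.exp_pos _).ne']

theorem hasGradientAt_tiltedRisk (ht : t ≠ 0) (hf : ∀ i, DifferentiableAt ℝ (f i) θ) :
    HasGradientAt (tiltedRisk f t) (∑ i, tiltWeight f t θ i • gradient (f i) θ) θ := by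
  have hsum : HasFDerivAt (fun θ => (1 / (N : ℝ)) * ∑ i, Real.exp (t * f i θ))
      ((1 / (N : ℝ)) • ∑ i, Real.exp (t * f i θ) •
        (t • InnerProductSpace.toDual ℝ _ (gradient (f i) θ))) θ :=
    (HasFDerivAt.fun_sum fun i _ => ((hf i).hasGradientAt.hasFDerivAt.const_mul t).exp).const_mul _
  have hexp : (1 / (N : ℝ)) * ∑ i, Real.exp (t * f i θ) = Real.exp (t * tiltedRisk f t θ) := by
    rw [exp_mul_tiltedRisk ht, Fintype.expect_eq_sum_div_card, Fintype.card_fin, one_div_mul_eq_div]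
  rw [hasGradientAt_iff_hasFDerivAt]
  refine ((hsum.log (hexp ▸ (Real.exp_pos _).ne')).const_mul (1 / t)).congr_fderiv ?_
  simp only [hexp, tiltWeight, map_sum, Finset.smul_sum, map_smul, smul_smul]
  refine Finset.sum_congr rfl fun i _ => ?_
  congr 1
  field_simp

theorem expect_inner_tiltedStochGrad (ht : t ≠ 0) (hf : ∀ i, DifferentiableAt ℝ (f i) θ)
    (v : EuclideanSpace ℝ (Fin d)) :
    𝔼 i, inner ℝ v (tiltedStochGrad f t i θ) = inner ℝ v (gradient (tiltedRisk f t) θ) := by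
  simp only [(hasGradientAt_tiltedRisk ht hf).gradient, inner_sum, inner_smul_right,
    sum_tiltWeight_mul, tiltedStochGrad]

theorem norm_gradient_tiltedRisk_le (ht : t ≠ 0) (hf : ∀ i, DifferentiableAt ℝ (f i) θ) {B : ℝ}
    (hB : ∀ i, ‖tiltedStochGrad f t i θ‖ ≤ B) : ‖gradient (tiltedRisk f t) θ‖ ≤ B := by
  set v := gradient (tiltedRisk f t) θ with hv
  have hsq : ‖v‖ * ‖v‖ ≤ ‖v‖ * B := by
    rw [← real_inner_self_eq_norm_mul_norm]
    nth_rewrite 2 [hv]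
    rw [← expect_inner_tiltedStochGrad ht hf]
    exact Finset.expect_le Finset.univ_nonempty fun i _ =>
      (real_inner_le_norm _ _).trans (by gcongr; exact hB i)
  rcases (norm_nonneg v).eq_or_lt with h | h
  · exact h ▸ (norm_nonneg _).trans (hB 0)
  · exact le_of_mul_le_mul_left hsq h

theorem tiltedRisk_sub_le (ht : 0 < t) :
    tiltedRisk f t θ - tiltedRisk f t θ'
      ≤ ∑ i, tiltWeight f t θ i * f i θ - ∑ i, tiltWeight f t θ i * f i θ' := by
  set p := tiltWeight f t θ with hp
  have hsimplex := tiltWeight_mem_stdSimplex (f := f) (θ := θ) ht.ne'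
  have hratio : ∑ i, p i * Real.exp (t * (f i θ' - f i θ))
      = Real.exp (t * (tiltedRisk f t θ' - tiltedRisk f t θ)) := by
    rw [sum_tiltWeight_mul, mul_sub, Real.exp_sub, exp_mul_tiltedRisk ht.ne' θ', Finset.expect_div]
    refine Finset.expect_congr rfl fun i _ => ?_
    rw [mul_sub, Real.exp_sub]
    field_simp
  have hjensen := convexOn_exp.map_sum_le (t := Finset.univ)
    (p := fun i => t * (f i θ' - f i θ)) (fun i _ => hsimplex.1 i) hsimplex.2
    (fun i _ => Set.mem_univ _)
  simp only [smul_eq_mul, ← hp] at hjensen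
  rw [hratio, Real.exp_le_exp] at hjensen
  simp only [mul_left_comm _ t, ← Finset.mul_sum, mul_sub, Finset.sum_sub_distrib] at hjensen
  refine le_of_mul_le_mul_left ?_ ht
  linarith

/- The tilt weights at `θ` give a mixture of the losses with the same gradient as the tilted risk at
`θ` and, by Jensen's inequality, at least the same suboptimality. -/
theorem tiltedRisk_PL (ht : 0 < t) {μ : ℝ} (hμ : 0 ≤ μ) (hθ : θ ∈ Θ) (hθ' : θ' ∈ Θ)
    (hf : ∀ i, DifferentiableAt ℝ (f i) θ)
    (hPL : ∀ p ∈ stdSimplex ℝ (Fin N), IsPLOn (μ / 2) (fun θ => ∑ i, p i * f i θ) Θ) :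
    μ * (tiltedRisk f t θ - tiltedRisk f t θ') ≤ ‖gradient (tiltedRisk f t) θ‖ ^ 2 := by
  have hmixture := hPL _ (tiltWeight_mem_stdSimplex (f := f) (θ := θ) ht.ne') θ hθ θ' hθ'
  rw [(hasGradientAt_sum_mul hf _).gradient, ← (hasGradientAt_tiltedRisk ht.ne' hf).gradient]
    at hmixture
  linarith [mul_le_mul_of_nonneg_left (tiltedRisk_sub_le (f := f) (θ := θ) (θ' := θ') ht) hμ]

end TiltedRisk

section Sampling

variable {Ω ι κ σ : Type*} [MeasurableSpace Ω] {P : Measure Ω} [MeasurableSpace κ]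
  [MeasurableSingletonClass κ]

theorem integral_comp_eq_integral_expect_of_indepFun [IsFiniteMeasure P] [Finite σ]
    [MeasurableSpace σ] [MeasurableSingletonClass σ] [Fintype κ] {X : Ω → σ} {Y : Ω → κ}
    (hX : Measurable X) (hY : Measurable Y) (hXY : IndepFun X Y P)
    (hunif : ∀ k, P.real (Y ⁻¹' {k}) = 1 / Fintype.card κ) (F : σ → κ → ℝ) :
    ∫ ω, F (X ω) (Y ω) ∂P = ∫ ω, 𝔼 k, F (X ω) k ∂P := by
  have hexpect (x : σ) : ∫ k, F x k ∂P.map Y = 𝔼 k, F x k := by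
    rw [integral_fintype .of_finite, Fintype.expect_eq_sum_div_card, Finset.sum_div]
    refine Finset.sum_congr rfl fun k _ => ?_
    rw [map_measureReal_apply hY (measurableSet_singleton k), hunif, smul_eq_mul,
      one_div_mul_eq_div]
  calc ∫ ω, F (X ω) (Y ω) ∂P
      = ∫ z, F z.1 z.2 ∂P.map fun ω => (X ω, Y ω) :=
        (integral_map (hX.prodMk hY).aemeasurable (f := fun z => F z.1 z.2)
          (measurable_of_finite _).aestronglyMeasurable).symm
    _ = ∫ x, ∫ k, F x k ∂P.map Y ∂P.map X := by
        rw [(indepFun_iff_map_prod_eq_prod_map_map hX.aemeasurable hY.aemeasurable).1 hXY,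
          integral_prod _ .of_finite]
    _ = ∫ ω, 𝔼 k, F (X ω) k ∂P := by
        simp only [hexpect]
        exact integral_map hX.aemeasurable (measurable_of_finite _).aestronglyMeasurable

variable {X : ι → Ω → κ} {S : Finset ι} {Φ : (ι → κ) → σ}

theorem integrable_comp_of_dependsOn [IsFiniteMeasure P] [Finite κ] (hX : ∀ a, Measurable (X a))
    {Φ : (ι → κ) → ℝ} (hΦ : DependsOn Φ S) : Integrable (fun ω => Φ fun a => X a ω) P := by
  obtain ⟨φ, rfl⟩ := dependsOn_iff_exists_comp.1 hΦ
  exact (Integrable.of_finite (f := φ)).comp_measurable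
    (measurable_pi_lambda (fun ω (a : (S : Set ι)) => X a ω) fun a => hX a)

theorem integral_comp_eq_integral_expect_of_dependsOn [Fintype κ]
    (hX : ∀ a, Measurable (X a)) (hindep : iIndepFun X P) {b : ι}
    (hunif : ∀ k, P.real (X b ⁻¹' {k}) = 1 / Fintype.card κ) (hb : b ∉ S) (hΦ : DependsOn Φ S)
    (F : σ → κ → ℝ) :
    ∫ ω, F (Φ fun a => X a ω) (X b ω) ∂P = ∫ ω, 𝔼 k, F (Φ fun a => X a ω) k ∂P := by
  have := hindep.isProbabilityMeasure
  have : Nonempty σ := (P.nonempty_of_neZero).map fun ω => Φ fun a => X a ω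
  obtain ⟨φ, rfl⟩ := dependsOn_iff_exists_comp.1 hΦ
  have hindep_b : IndepFun (fun ω (a : (S : Set ι)) => X a ω) (X b) P :=
    (hindep.indepFun_finset S {b} (Finset.disjoint_singleton_right.2 hb) hX).comp measurable_id
      (measurable_pi_apply (⟨b, Finset.mem_singleton_self b⟩ : ({b} : Finset ι)))
  exact integral_comp_eq_integral_expect_of_indepFun
    (measurable_pi_lambda (fun ω (a : (S : Set ι)) => X a ω) fun a => hX a) (hX b) hindep_b hunif
    fun x => F (φ x)

/-- The samples `i` and `j` are drawn afresh in the random state `s`: `j` is uniform given `s`, and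
`i` is uniform given `s` and `j`. This is encoded by averaging over the values of the samples, with
no measurability requirement on the integrands since everything takes finitely many values. -/
structure IsFreshPair [Fintype κ] (P : Measure Ω) (s : Ω → σ) (i j : Ω → κ) : Prop where
  integrable (H : σ → κ → κ → ℝ) : Integrable (fun ω => H (s ω) (i ω) (j ω)) P
  integral_fst (H : σ → κ → κ → ℝ) :
    ∫ ω, H (s ω) (i ω) (j ω) ∂P = ∫ ω, 𝔼 k, H (s ω) k (j ω) ∂P
  integral_snd (H : σ → κ → ℝ) : ∫ ω, H (s ω) (j ω) ∂P = ∫ ω, 𝔼 k, H (s ω) k ∂P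

theorem isFreshPair_of_dependsOn [Fintype κ] (hX : ∀ a, Measurable (X a)) (hindep : iIndepFun X P)
    (hΦ : DependsOn Φ S) {b c : ι} (hb : b ∉ S) (hc : c ∉ S) (hbc : b ≠ c)
    (hb_unif : ∀ k, P.real (X b ⁻¹' {k}) = 1 / Fintype.card κ)
    (hc_unif : ∀ k, P.real (X c ⁻¹' {k}) = 1 / Fintype.card κ) :
    IsFreshPair P (fun ω => Φ fun a => X a ω) (X b) (X c) := by
  classical
  have := hindep.isProbabilityMeasure
  refine ⟨fun H => ?_, fun H => ?_, integral_comp_eq_integral_expect_of_dependsOn hX hindep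
    hc_unif hc hΦ⟩
  · refine integrable_comp_of_dependsOn (S := insert b (insert c S))
      (Φ := fun x => H (Φ x) (x b) (x c)) hX fun x y hxy => ?_
    simp only [Finset.mem_coe, Finset.forall_mem_insert] at hxy
    simp only [hΦ hxy.2.2, hxy.1, hxy.2.1]
  · refine integral_comp_eq_integral_expect_of_dependsOn (S := insert c S)
      (Φ := fun x => (Φ x, x c)) hX hindep hb_unif
      (by simp only [Finset.mem_insert, hbc, hb, or_self, not_false_eq_true])
      (fun x y hxy => ?_) (fun z k => H z.1 k z.2)
    simp only [Finset.mem_coe, Finset.forall_mem_insert] at hxy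
    simp only [hΦ hxy.2, hxy.1]

end Sampling

section Run

variable {d N : ℕ} {f : Fin N → EuclideanSpace ℝ (Fin d) → ℝ} {t lam : ℝ} {α : ℕ → ℝ}
  {θ₁ : EuclideanSpace ℝ (Fin d)}

theorem dependsOn_run (n : ℕ) :
    DependsOn
      (fun x : ℕ ⊕ ℕ → Fin N => run f t lam α θ₁ (fun k => x (.inl k)) (fun k => x (.inr k)) n)
      ((Finset.Icc 1 n).disjSum (Finset.Icc 1 n) : Finset (ℕ ⊕ ℕ)) := by
  induction n with
  | zero => exact fun _ _ _ => rfl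
  | succ n ih =>
    intro x y hxy
    have hrun := ih fun a ha => hxy a <| Finset.disjSum_mono
      (Finset.Icc_subset_Icc_right n.le_succ) (Finset.Icc_subset_Icc_right n.le_succ) ha
    simp only [run, hrun, hxy (.inl (n + 1)) (by simp), hxy (.inr (n + 1)) (by simp)]

theorem isFreshPair_run {Ω : Type*} [MeasurableSpace Ω] {P : Measure Ω} {ζ ξ : ℕ → Ω → Fin N}
    (hζ_meas : ∀ k, Measurable (ζ k)) (hξ_meas : ∀ k, Measurable (ξ k))
    (hindep : iIndepFun (Sum.elim ζ ξ) P)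
    (hζ_unif : ∀ k i, P.real (ζ k ⁻¹' {i}) = 1 / (N : ℝ))
    (hξ_unif : ∀ k i, P.real (ξ k ⁻¹' {i}) = 1 / (N : ℝ)) (n : ℕ) :
    IsFreshPair P (fun ω => run f t lam α θ₁ (fun k => ζ k ω) (fun k => ξ k ω) n)
      (ζ (n + 1)) (ξ (n + 1)) :=
  isFreshPair_of_dependsOn (X := Sum.elim ζ ξ) (b := .inl (n + 1)) (c := .inr (n + 1))
    (Sum.rec hζ_meas hξ_meas) hindep (dependsOn_run n) (by simp) (by simp) (by simp)
    (by simpa only [Fintype.card_fin, Sum.elim_inl] using hζ_unif (n + 1))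
    (by simpa only [Fintype.card_fin, Sum.elim_inr] using hξ_unif (n + 1))

end Run

section Step

variable {d N : ℕ} {f : Fin N → EuclideanSpace ℝ (Fin d) → ℝ} {t lam a : ℝ} {i j : Fin N}
  {s : EuclideanSpace ℝ (Fin d) × ℝ} {Θ : Set (EuclideanSpace ℝ (Fin d))}

/-- The estimate `r_k` of the tilted risk after a pass of the solver from the state `s` with the
sample `j`; it does not involve the gradient sample. -/
noncomputable def newEstimate (f : Fin N → EuclideanSpace ℝ (Fin d) → ℝ) (t lam : ℝ) (j : Fin N)
    (s : EuclideanSpace ℝ (Fin d) × ℝ) : ℝ :=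
  1 / t * Real.log ((1 - lam) * Real.exp (t * s.2) + lam * Real.exp (t * f j s.1))

/-- The multiplicative error `exp (t (r_k - R(t; θ_k)))` of the normalization used by the solver in
a pass from the state `s` with the sample `j`. -/
noncomputable def estimateRatio (f : Fin N → EuclideanSpace ℝ (Fin d) → ℝ) (t lam : ℝ) (j : Fin N)
    (s : EuclideanSpace ℝ (Fin d) × ℝ) : ℝ :=
  Real.exp (t * (newEstimate f t lam j s - tiltedRisk f t s.1))

theorem estimateRatio_pos : 0 < estimateRatio f t lam j s := Real.exp_pos _

theorem step_snd : (step f t lam a i j s).2 = newEstimate f t lam j s := rfl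

theorem step_fst : (step f t lam a i j s).1
    = s.1 - (a * (estimateRatio f t lam j s)⁻¹) • tiltedStochGrad f t i s.1 := by
  have hweight : Real.exp (t * f i s.1 - t * newEstimate f t lam j s)
      = (estimateRatio f t lam j s)⁻¹ *
        (Real.exp (t * f i s.1) / Real.exp (t * tiltedRisk f t s.1)) := by
    rw [estimateRatio, ← Real.exp_neg, ← Real.exp_sub, ← Real.exp_add]
    ring_nf
  rw [tiltedStochGrad, smul_smul, mul_assoc, ← hweight, mul_smul]
  rfl

theorem exp_mul_newEstimate (ht : t ≠ 0) (hlam : lam ∈ Set.Icc (0 : ℝ) 1) :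
    Real.exp (t * newEstimate f t lam j s)
      = (1 - lam) * Real.exp (t * s.2) + lam * Real.exp (t * f j s.1) := by
  rw [newEstimate, ← mul_assoc, mul_one_div_cancel ht, one_mul, Real.exp_log]
  exact convex_Ioi (0 : ℝ) (Real.exp_pos _) (Real.exp_pos _) (sub_nonneg.2 hlam.2) hlam.1
    (sub_add_cancel 1 lam)

theorem newEstimate_mem_Icc (ht : 0 < t) (hlam : lam ∈ Set.Icc (0 : ℝ) 1) {b c : ℝ}
    (hs : s.2 ∈ Set.Icc b c) (hf : f j s.1 ∈ Set.Icc b c) :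
    newEstimate f t lam j s ∈ Set.Icc b c := by
  have hexp : ∀ x ∈ Set.Icc b c, Real.exp (t * x) ∈ Set.Icc (Real.exp (t * b)) (Real.exp (t * c)) :=
    fun x hx => ⟨by gcongr; exact hx.1, by gcongr; exact hx.2⟩
  have h := convex_Icc _ _ (hexp _ hs) (hexp _ hf) (sub_nonneg.2 hlam.2) hlam.1
    (sub_add_cancel 1 lam)
  simp only [smul_eq_mul, ← exp_mul_newEstimate ht.ne' hlam] at h
  exact ⟨le_of_mul_le_mul_left (Real.exp_le_exp.1 h.1) ht,
    le_of_mul_le_mul_left (Real.exp_le_exp.1 h.2) ht⟩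

theorem tiltedRisk_step_le (hΘ : IsOpen Θ) {β : ℝ≥0} {B : ℝ}
    (hR : IsSmoothOn β (tiltedRisk f t) Θ) (hB : ‖tiltedStochGrad f t i s.1‖ ≤ B)
    (hs : segment ℝ s.1 (step f t lam a i j s).1 ⊆ Θ) :
    tiltedRisk f t (step f t lam a i j s).1 ≤ tiltedRisk f t s.1
      - a * (estimateRatio f t lam j s)⁻¹
        * inner ℝ (gradient (tiltedRisk f t) s.1) (tiltedStochGrad f t i s.1)
      + β / 2 * (a * (estimateRatio f t lam j s)⁻¹ * B) ^ 2 := by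
  have h := le_quadratic_of_lipschitzOnWith_gradient
    (fun z hz => hR.1.differentiableAt (hΘ.mem_nhds (hs hz))) (hR.2.mono hs)
  have hsq : ‖(step f t lam a i j s).1 - s.1‖ ^ 2
      ≤ (a * (estimateRatio f t lam j s)⁻¹ * B) ^ 2 := by
    rw [step_fst, sub_sub_cancel_left, norm_neg, norm_smul, mul_pow, mul_pow, Real.norm_eq_abs,
      sq_abs]
    gcongr
  have hinner : inner ℝ (gradient (tiltedRisk f t) s.1) ((step f t lam a i j s).1 - s.1)
      = -(a * (estimateRatio f t lam j s)⁻¹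
        * inner ℝ (gradient (tiltedRisk f t) s.1) (tiltedStochGrad f t i s.1)) := by
    rw [step_fst, sub_sub_cancel_left, inner_neg_right, inner_smul_right]
  have hβ := mul_le_mul_of_nonneg_left hsq (by positivity : (0 : ℝ) ≤ β / 2)
  linarith

variable [NeZero N]

theorem expect_estimateRatio_step (ht : t ≠ 0) (hlam : lam ∈ Set.Icc (0 : ℝ) 1) :
    𝔼 k, estimateRatio f t lam k (step f t lam a i j s)
      = (1 - lam) * (Real.exp (t * (tiltedRisk f t s.1 - tiltedRisk f t (step f t lam a i j s).1))
        * estimateRatio f t lam j s) + lam := by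
  simp only [estimateRatio, mul_sub, Real.exp_sub, exp_mul_newEstimate ht hlam]
  rw [← Finset.expect_div, Finset.expect_add_distrib, Fintype.expect_const, ← Finset.mul_expect,
    ← exp_mul_tiltedRisk ht, step_snd, ← exp_mul_newEstimate ht hlam]
  field_simp

theorem estimateRatio_mem_Icc {b c : ℝ} (ht : 0 < t) (hlam : lam ∈ Set.Icc (0 : ℝ) 1)
    (hs : s.2 ∈ Set.Icc b c) (hf : ∀ i, f i s.1 ∈ Set.Icc b c) :
    estimateRatio f t lam j s ∈ Set.Icc (Real.exp (t * (c - b)))⁻¹ (Real.exp (t * (c - b))) := by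
  have hr := newEstimate_mem_Icc ht hlam hs (hf j)
  have hR := tiltedRisk_mem_Icc ht hf
  rw [← Real.exp_neg, ← mul_neg, neg_sub]
  constructor <;> unfold estimateRatio <;> gcongr
  exacts [hr.1, hR.2, hr.2, hR.1]

theorem abs_tiltedRisk_step_sub_le (hΘ : IsOpen Θ) (ht : t ≠ 0) (ha : 0 ≤ a) {B : ℝ}
    (hf : ∀ i, DifferentiableOn ℝ (f i) Θ)
    (hB : ∀ i, ∀ θ ∈ Θ, ‖tiltedStochGrad f t i θ‖ ≤ B)
    (hs : segment ℝ s.1 (step f t lam a i j s).1 ⊆ Θ) :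
    |tiltedRisk f t (step f t lam a i j s).1 - tiltedRisk f t s.1|
      ≤ a * (estimateRatio f t lam j s)⁻¹ * B ^ 2 := by
  have hfz : ∀ z ∈ segment ℝ s.1 (step f t lam a i j s).1, ∀ k, DifferentiableAt ℝ (f k) z :=
    fun z hz k => (hf k).differentiableAt (hΘ.mem_nhds (hs hz))
  have hs₁ : s.1 ∈ Θ := hs (left_mem_segment ℝ _ _)
  have hB_nonneg : 0 ≤ B := (norm_nonneg _).trans (hB i s.1 hs₁)
  have hratio : 0 < estimateRatio f t lam j s := estimateRatio_pos
  calc |tiltedRisk f t (step f t lam a i j s).1 - tiltedRisk f t s.1|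
      ≤ B * ‖(step f t lam a i j s).1 - s.1‖ := abs_sub_le_of_norm_gradient_le
        (fun z hz => (hasGradientAt_tiltedRisk ht (hfz z hz)).differentiableAt)
        (fun z hz => norm_gradient_tiltedRisk_le ht (hfz z hz) fun k => hB k z (hs hz))
    _ = B * (a * (estimateRatio f t lam j s)⁻¹ * ‖tiltedStochGrad f t i s.1‖) := by
        rw [step_fst, sub_sub_cancel_left, norm_neg, norm_smul, Real.norm_of_nonneg (by positivity)]
    _ ≤ B * (a * (estimateRatio f t lam j s)⁻¹ * B) := by gcongr; exact hB i s.1 hs₁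
    _ = a * (estimateRatio f t lam j s)⁻¹ * B ^ 2 := by ring

/- The new estimate forgets the old one at rate `1 - lam`; the part it keeps is distorted by the
drift of the tilted risk. -/
theorem expect_estimateRatio_step_mul_le (hΘ : IsOpen Θ) (ht : 0 < t)
    (hlam : lam ∈ Set.Icc (0 : ℝ) 1) (ha : 0 ≤ a) {B q m : ℝ}
    (hf : ∀ i, DifferentiableOn ℝ (f i) Θ)
    (hB : ∀ i, ∀ θ ∈ Θ, ‖tiltedStochGrad f t i θ‖ ≤ B)
    (hm : m ≤ tiltedRisk f t (step f t lam a i j s).1)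
    (hs : segment ℝ s.1 (step f t lam a i j s).1 ⊆ Θ) (hq : (estimateRatio f t lam j s)⁻¹ ≤ q) :
    𝔼 k, estimateRatio f t lam k (step f t lam a i j s)
        * (tiltedRisk f t (step f t lam a i j s).1 - m)
      ≤ (1 - lam) * Real.exp (t * (a * q * B ^ 2))
          * (estimateRatio f t lam j s * (tiltedRisk f t s.1 - m) + a * B ^ 2)
        + lam * (tiltedRisk f t (step f t lam a i j s).1 - m) := by
  have hratio : 0 < estimateRatio f t lam j s := estimateRatio_pos
  have hdrift := abs_le.1 (abs_tiltedRisk_step_sub_le hΘ ht.ne' ha hf hB hs)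
  have hexp : tiltedRisk f t s.1 - tiltedRisk f t (step f t lam a i j s).1 ≤ a * q * B ^ 2 :=
    calc _ ≤ a * (estimateRatio f t lam j s)⁻¹ * B ^ 2 := by linarith
      _ ≤ a * q * B ^ 2 := by gcongr
  have hkept : estimateRatio f t lam j s * (tiltedRisk f t (step f t lam a i j s).1 - m)
      ≤ estimateRatio f t lam j s * (tiltedRisk f t s.1 - m) + a * B ^ 2 := by
    have h := mul_le_mul_of_nonneg_left hdrift.2 hratio.le
    rw [mul_assoc a, mul_left_comm, mul_inv_cancel_left₀ hratio.ne'] at h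
    linarith
  have hlam' := sub_nonneg.2 hlam.2
  have := sub_nonneg.2 hm
  rw [← Finset.expect_mul, expect_estimateRatio_step ht.ne' hlam, add_mul, mul_assoc, mul_assoc,
    mul_assoc (1 - lam)]
  gcongr

end Step

section ExpectedStep

variable {Ω : Type*} [MeasurableSpace Ω] {P : Measure Ω} {d N : ℕ}
  {f : Fin N → EuclideanSpace ℝ (Fin d) → ℝ} {t lam a q m B μ : ℝ}
  {Θ : Set (EuclideanSpace ℝ (Fin d))} {s : Ω → EuclideanSpace ℝ (Fin d) × ℝ} {i j : Ω → Fin N}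

theorem integral_tiltedRisk_sub_le [IsProbabilityMeasure P] (hfresh : IsFreshPair P s i j) {c : ℝ}
    (h : ∀ᵐ ω ∂P, tiltedRisk f t (s ω).1 - m ≤ c) :
    ∫ ω, (tiltedRisk f t (s ω).1 - m) ∂P ≤ c := by
  simpa using integral_mono_ae (hfresh.integrable fun s _ _ => tiltedRisk f t s.1 - m)
    (integrable_const c) h

theorem integral_le_mul_integral_inv_estimateRatio_mul (hfresh : IsFreshPair P s i j)
    (hm : ∀ᵐ ω ∂P, m ≤ tiltedRisk f t (s ω).1)
    (hq : ∀ᵐ ω ∂P, estimateRatio f t lam (j ω) (s ω) ≤ q) :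
    ∫ ω, (tiltedRisk f t (s ω).1 - m) ∂P
      ≤ q * ∫ ω, (estimateRatio f t lam (j ω) (s ω))⁻¹ * (tiltedRisk f t (s ω).1 - m) ∂P := by
  rw [← integral_const_mul]
  refine integral_mono_ae (hfresh.integrable fun s _ _ => tiltedRisk f t s.1 - m)
    (hfresh.integrable fun s _ j =>
      q * ((estimateRatio f t lam j s)⁻¹ * (tiltedRisk f t s.1 - m))) ?_
  filter_upwards [hm, hq] with ω hmω hqω
  rw [← mul_assoc, ← div_eq_mul_inv]
  exact le_mul_of_one_le_left (sub_nonneg.2 hmω) ((one_le_div estimateRatio_pos).2 hqω)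

theorem integral_estimateRatio_mul_le_mul_integral (hfresh : IsFreshPair P s i j)
    (hm : ∀ᵐ ω ∂P, m ≤ tiltedRisk f t (s ω).1)
    (hq : ∀ᵐ ω ∂P, estimateRatio f t lam (j ω) (s ω) ≤ q) :
    ∫ ω, estimateRatio f t lam (j ω) (s ω) * (tiltedRisk f t (s ω).1 - m) ∂P
      ≤ q * ∫ ω, (tiltedRisk f t (s ω).1 - m) ∂P := by
  rw [← integral_const_mul]
  refine integral_mono_ae
    (hfresh.integrable fun s _ j => estimateRatio f t lam j s * (tiltedRisk f t s.1 - m))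
    (hfresh.integrable fun s _ _ => q * (tiltedRisk f t s.1 - m)) ?_
  filter_upwards [hm, hq] with ω hmω hqω
  exact mul_le_mul_of_nonneg_right hqω (sub_nonneg.2 hmω)

theorem integral_sub_le_integral_inv_estimateRatio_mul (hfresh : IsFreshPair P s i j)
    (hm : ∀ᵐ ω ∂P, m ≤ tiltedRisk f t (s ω).1) :
    ∫ ω, (tiltedRisk f t (s ω).1 - m) ∂P
        - (∫ ω, estimateRatio f t lam (j ω) (s ω) * (tiltedRisk f t (s ω).1 - m) ∂P) / 4
      ≤ ∫ ω, (estimateRatio f t lam (j ω) (s ω))⁻¹ * (tiltedRisk f t (s ω).1 - m) ∂P := by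
  have hgap := hfresh.integrable fun s _ _ => tiltedRisk f t s.1 - m
  have hcorr := hfresh.integrable fun s _ j =>
    estimateRatio f t lam j s * (tiltedRisk f t s.1 - m) / 4
  rw [← integral_div, ← integral_sub hgap hcorr]
  refine integral_mono_ae (hgap.sub hcorr)
    (hfresh.integrable fun s _ j => (estimateRatio f t lam j s)⁻¹ * (tiltedRisk f t s.1 - m)) ?_
  filter_upwards [hm] with ω hmω
  have hratio : 0 < estimateRatio f t lam (j ω) (s ω) := estimateRatio_pos
  have h : 1 - estimateRatio f t lam (j ω) (s ω) / 4
      ≤ (estimateRatio f t lam (j ω) (s ω))⁻¹ := by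
    rw [← one_div, le_div_iff₀ hratio]
    linarith [sq_nonneg (estimateRatio f t lam (j ω) (s ω) / 2 - 1)]
  linarith [mul_le_mul_of_nonneg_right h (sub_nonneg.2 hmω)]

variable [NeZero N]

theorem mul_integral_inv_estimateRatio_mul_le (hfresh : IsFreshPair P s i j) (ht : t ≠ 0)
    (hf : ∀ᵐ ω ∂P, ∀ k, DifferentiableAt ℝ (f k) (s ω).1)
    (hPL : ∀ᵐ ω ∂P,
      μ * (tiltedRisk f t (s ω).1 - m) ≤ ‖gradient (tiltedRisk f t) (s ω).1‖ ^ 2) :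
    μ * ∫ ω, (estimateRatio f t lam (j ω) (s ω))⁻¹ * (tiltedRisk f t (s ω).1 - m) ∂P
      ≤ ∫ ω, (estimateRatio f t lam (j ω) (s ω))⁻¹
        * inner ℝ (gradient (tiltedRisk f t) (s ω).1) (tiltedStochGrad f t (i ω) (s ω).1) ∂P := by
  rw [hfresh.integral_fst fun s i j => (estimateRatio f t lam j s)⁻¹
    * inner ℝ (gradient (tiltedRisk f t) s.1) (tiltedStochGrad f t i s.1), ← integral_const_mul]
  refine integral_mono_ae
    (hfresh.integrable fun s _ j =>
      μ * ((estimateRatio f t lam j s)⁻¹ * (tiltedRisk f t s.1 - m)))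
    (hfresh.integrable fun s _ j => 𝔼 k, (estimateRatio f t lam j s)⁻¹
      * inner ℝ (gradient (tiltedRisk f t) s.1) (tiltedStochGrad f t k s.1)) ?_
  filter_upwards [hf, hPL] with ω hfω hPLω
  simp only [← Finset.mul_expect, expect_inner_tiltedStochGrad ht hfω, real_inner_self_eq_norm_sq]
  rw [mul_left_comm]
  exact mul_le_mul_of_nonneg_left hPLω (inv_nonneg.2 estimateRatio_pos.le)

theorem integral_tiltedRisk_step_le [IsProbabilityMeasure P] (hfresh : IsFreshPair P s i j)
    (hΘ : IsOpen Θ) (ht : t ≠ 0) (ha : 0 ≤ a) {β : ℝ≥0}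
    (hf : ∀ i, DifferentiableOn ℝ (f i) Θ) (hR : IsSmoothOn β (tiltedRisk f t) Θ)
    (hB : ∀ i, ∀ θ ∈ Θ, ‖tiltedStochGrad f t i θ‖ ≤ B)
    (hPL : ∀ θ ∈ Θ, μ * (tiltedRisk f t θ - m) ≤ ‖gradient (tiltedRisk f t) θ‖ ^ 2)
    (hstay : ∀ᵐ ω ∂P, segment ℝ (s ω).1 (step f t lam a (i ω) (j ω) (s ω)).1 ⊆ Θ)
    (hq : ∀ᵐ ω ∂P, (estimateRatio f t lam (j ω) (s ω))⁻¹ ≤ q) :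
    ∫ ω, (tiltedRisk f t (step f t lam a (i ω) (j ω) (s ω)).1 - m) ∂P
      ≤ ∫ ω, (tiltedRisk f t (s ω).1 - m) ∂P
        - a * (μ * ∫ ω, (estimateRatio f t lam (j ω) (s ω))⁻¹ * (tiltedRisk f t (s ω).1 - m) ∂P)
        + β / 2 * (a * q * B) ^ 2 := by
  have hs : ∀ᵐ ω ∂P, (s ω).1 ∈ Θ := hstay.mono fun ω hω => hω (left_mem_segment ℝ _ _)
  have hdescent : ∫ ω, (tiltedRisk f t (step f t lam a (i ω) (j ω) (s ω)).1 - m) ∂P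
      ≤ ∫ ω, ((tiltedRisk f t (s ω).1 - m) - a * ((estimateRatio f t lam (j ω) (s ω))⁻¹
        * inner ℝ (gradient (tiltedRisk f t) (s ω).1) (tiltedStochGrad f t (i ω) (s ω).1))
        + β / 2 * (a * q * B) ^ 2) ∂P := by
    refine integral_mono_ae
      (hfresh.integrable fun s i j => tiltedRisk f t (step f t lam a i j s).1 - m)
      (hfresh.integrable fun s i j => tiltedRisk f t s.1 - m - a * ((estimateRatio f t lam j s)⁻¹
        * inner ℝ (gradient (tiltedRisk f t) s.1) (tiltedStochGrad f t i s.1)) + _) ?_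
    filter_upwards [hstay, hs, hq] with ω hω hsω hqω
    have hstep := tiltedRisk_step_le hΘ hR (hB (i ω) _ hsω) hω
    have hsq : (a * (estimateRatio f t lam (j ω) (s ω))⁻¹ * B) ^ 2 ≤ (a * q * B) ^ 2 := by
      have hratio : 0 < estimateRatio f t lam (j ω) (s ω) := estimateRatio_pos
      have hB_nonneg : 0 ≤ B := (norm_nonneg _).trans (hB (i ω) _ hsω)
      gcongr
    linarith [mul_le_mul_of_nonneg_left hsq (by positivity : (0 : ℝ) ≤ β / 2)]
  rw [integral_add (hfresh.integrable fun s i j => tiltedRisk f t s.1 - m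
      - a * ((estimateRatio f t lam j s)⁻¹
        * inner ℝ (gradient (tiltedRisk f t) s.1) (tiltedStochGrad f t i s.1)))
      (integrable_const _),
    integral_sub (hfresh.integrable fun s _ _ => tiltedRisk f t s.1 - m)
      (hfresh.integrable fun s i j => a * ((estimateRatio f t lam j s)⁻¹
        * inner ℝ (gradient (tiltedRisk f t) s.1) (tiltedStochGrad f t i s.1))),
    integral_const_mul, integral_const, probReal_univ, one_smul] at hdescent
  linarith [mul_le_mul_of_nonneg_left (mul_integral_inv_estimateRatio_mul_le (lam := lam) hfresh ht
    (hs.mono fun ω hsω k => (hf k).differentiableAt (hΘ.mem_nhds hsω))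
    (hs.mono fun ω hsω => hPL _ hsω)) ha]

theorem integral_tiltedRisk_le_integral_step [IsProbabilityMeasure P] (hfresh : IsFreshPair P s i j)
    (hΘ : IsOpen Θ) (ht : t ≠ 0) (ha : 0 ≤ a) (hf : ∀ i, DifferentiableOn ℝ (f i) Θ)
    (hB : ∀ i, ∀ θ ∈ Θ, ‖tiltedStochGrad f t i θ‖ ≤ B)
    (hstay : ∀ᵐ ω ∂P, segment ℝ (s ω).1 (step f t lam a (i ω) (j ω) (s ω)).1 ⊆ Θ)
    (hq : ∀ᵐ ω ∂P, (estimateRatio f t lam (j ω) (s ω))⁻¹ ≤ q) :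
    ∫ ω, (tiltedRisk f t (s ω).1 - m) ∂P
      ≤ ∫ ω, (tiltedRisk f t (step f t lam a (i ω) (j ω) (s ω)).1 - m) ∂P + a * q * B ^ 2 := by
  have hint := hfresh.integrable fun s i j => tiltedRisk f t (step f t lam a i j s).1 - m
  calc ∫ ω, (tiltedRisk f t (s ω).1 - m) ∂P
      ≤ ∫ ω, (tiltedRisk f t (step f t lam a (i ω) (j ω) (s ω)).1 - m + a * q * B ^ 2) ∂P := by
        refine integral_mono_ae (hfresh.integrable fun s _ _ => tiltedRisk f t s.1 - m)
          (hint.add (integrable_const _)) ?_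
        filter_upwards [hstay, hq] with ω hω hqω
        have hdrift := (abs_le.1 (abs_tiltedRisk_step_sub_le hΘ ht ha hf hB hω)).1
        have hle : a * (estimateRatio f t lam (j ω) (s ω))⁻¹ * B ^ 2 ≤ a * q * B ^ 2 := by gcongr
        linarith
    _ = _ := by rw [integral_add hint (integrable_const _), integral_const, probReal_univ, one_smul]

theorem integral_estimateRatio_step_mul_le [IsProbabilityMeasure P] {i' j' : Ω → Fin N}
    (hfresh : IsFreshPair P s i j)
    (hfresh' : IsFreshPair P (fun ω => step f t lam a (i ω) (j ω) (s ω)) i' j')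
    (hΘ : IsOpen Θ) (ht : 0 < t) (hlam : lam ∈ Set.Icc (0 : ℝ) 1) (ha : 0 ≤ a)
    (hf : ∀ i, DifferentiableOn ℝ (f i) Θ) (hB : ∀ i, ∀ θ ∈ Θ, ‖tiltedStochGrad f t i θ‖ ≤ B)
    (hm : ∀ θ ∈ Θ, m ≤ tiltedRisk f t θ)
    (hstay : ∀ᵐ ω ∂P, segment ℝ (s ω).1 (step f t lam a (i ω) (j ω) (s ω)).1 ⊆ Θ)
    (hq : ∀ᵐ ω ∂P, (estimateRatio f t lam (j ω) (s ω))⁻¹ ≤ q) :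
    ∫ ω, estimateRatio f t lam (j' ω) (step f t lam a (i ω) (j ω) (s ω))
        * (tiltedRisk f t (step f t lam a (i ω) (j ω) (s ω)).1 - m) ∂P
      ≤ (1 - lam) * Real.exp (t * (a * q * B ^ 2))
          * (∫ ω, estimateRatio f t lam (j ω) (s ω) * (tiltedRisk f t (s ω).1 - m) ∂P + a * B ^ 2)
        + lam * ∫ ω, (tiltedRisk f t (step f t lam a (i ω) (j ω) (s ω)).1 - m) ∂P := by
  have hint := hfresh.integrable fun s _ j => estimateRatio f t lam j s * (tiltedRisk f t s.1 - m)
  have hint_add := hfresh.integrable fun s _ j =>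
    estimateRatio f t lam j s * (tiltedRisk f t s.1 - m) + a * B ^ 2
  have hint' := hfresh.integrable fun s i j => tiltedRisk f t (step f t lam a i j s).1 - m
  rw [hfresh'.integral_snd fun s j => estimateRatio f t lam j s * (tiltedRisk f t s.1 - m)]
  calc ∫ ω, 𝔼 k, estimateRatio f t lam k (step f t lam a (i ω) (j ω) (s ω))
        * (tiltedRisk f t (step f t lam a (i ω) (j ω) (s ω)).1 - m) ∂P
      ≤ ∫ ω, ((1 - lam) * Real.exp (t * (a * q * B ^ 2))
          * (estimateRatio f t lam (j ω) (s ω) * (tiltedRisk f t (s ω).1 - m) + a * B ^ 2)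
        + lam * (tiltedRisk f t (step f t lam a (i ω) (j ω) (s ω)).1 - m)) ∂P := by
        refine integral_mono_ae
          (hfresh.integrable fun s i j => 𝔼 k, estimateRatio f t lam k (step f t lam a i j s)
            * (tiltedRisk f t (step f t lam a i j s).1 - m))
          ((hint_add.const_mul _).add (hint'.const_mul _)) ?_
        filter_upwards [hstay, hq] with ω hω hqω
        exact expect_estimateRatio_step_mul_le hΘ ht hlam ha hf hB
          (hm _ (hω (right_mem_segment ℝ _ _))) hω hqω
    _ = _ := by
        rw [integral_add (hint_add.const_mul _) (hint'.const_mul _),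
          integral_const_mul, integral_const_mul, integral_add hint (integrable_const _),
          integral_const, probReal_univ, one_smul]

end ExpectedStep

section Recursion

theorem le_div_succ_of_le {D D' V k c : ℝ} (hk : 0 < k) (hc : c ≤ k) (hV : 0 ≤ V)
    (hD : D ≤ V / k) (hD' : D' ≤ (1 - c / k) * D + (c - 1) * (V / k ^ 2)) : D' ≤ V / (k + 1) := by
  have hcoeff : 0 ≤ 1 - c / k := by rwa [sub_nonneg, div_le_one hk]
  calc D' ≤ (1 - c / k) * (V / k) + (c - 1) * (V / k ^ 2) := by
        linarith [mul_le_mul_of_nonneg_left hD hcoeff]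
    _ = V / (k + 1) - V / (k ^ 2 * (k + 1)) := by field_simp; ring
    _ ≤ V / (k + 1) := sub_le_self _ (by positivity)

theorem le_pow_mul_add_of_succ_le_half {X : ℕ → ℝ} {c : ℝ} (hc : 0 ≤ c)
    (hX : ∀ i, X (i + 1) ≤ X i / 2 + c) (i : ℕ) : X i ≤ (1 / 2) ^ i * X 0 + 2 * c := by
  induction i with
  | zero => linarith
  | succ i ih => rw [pow_succ]; linarith [hX i]

theorem one_half_pow_sub_half_le (n : ℕ) : (1 / 2 : ℝ) ^ (n - n / 2) ≤ 2 / (n + 1) := by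
  have h : n + 1 ≤ 2 * 2 ^ (n - n / 2) := by
    have := (n - n / 2).lt_two_pow_self
    omega
  rw [one_div_pow, div_le_div_iff₀ (by positivity) (by positivity)]
  exact_mod_cast (one_mul _).trans_le h

theorem noise_le {μ β B q V a k : ℝ} (hμ : 0 < μ) (ha : a = 4 * Real.exp 1 / (μ * k))
    (hV : 8 * β * B ^ 2 * (Real.exp 1 * q) ^ 2 / μ ^ 2 ≤ V) :
    β / 2 * (a * q * B) ^ 2 ≤ V / k ^ 2 :=
  calc β / 2 * (a * q * B) ^ 2 = 8 * β * B ^ 2 * (Real.exp 1 * q) ^ 2 / μ ^ 2 / k ^ 2 := by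
        rw [ha]; field_simp; ring
    _ ≤ V / k ^ 2 := by gcongr

theorem drift_le {μ β B q V a k : ℝ} (hμ : 0 < μ) (hk : 0 < k) (hβ : μ ≤ 2 * β)
    (ha : a = 4 * Real.exp 1 / (μ * k)) (hV : 8 * β * B ^ 2 * (Real.exp 1 * q) ^ 2 / μ ^ 2 ≤ V) :
    Real.exp 1 * q * (a * q * B ^ 2) ≤ V / k :=
  calc Real.exp 1 * q * (a * q * B ^ 2) = μ / 4 * (a * q * B) ^ 2 * k := by
        rw [ha]; field_simp
    _ ≤ β / 2 * (a * q * B) ^ 2 * k := by gcongr ?_ * _ * _; linarith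
    _ ≤ V / k ^ 2 * k := by gcongr; exact noise_le hμ ha hV
    _ = V / k := by field_simp

/-- The expected quantities of the solver after `n` passes and the inequalities that link them:
`D n` is the mean suboptimality, `A n` and `W n` are its means weighted by the next value of
`estimateRatio` and by its inverse. The bound `q` is one for `estimateRatio` and its inverse,
and `α (n + 1)` is the step size of the next pass. -/
structure IsDescentSystem (D A W α : ℕ → ℝ) (t μ β B q : ℝ) : Prop where
  nonneg (n : ℕ) : 0 ≤ D n
  correlation_nonneg (n : ℕ) : 0 ≤ A n
  le_sq_div (n : ℕ) : D n ≤ B ^ 2 / μ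
  exp_le (n : ℕ) : Real.exp (t * D n) ≤ q
  le_mul_inv_correlation (n : ℕ) : D n ≤ q * W n
  sub_le_inv_correlation (n : ℕ) : D n - A n / 4 ≤ W n
  correlation_le_mul (n : ℕ) : A n ≤ q * D n
  descent (n : ℕ) : D (n + 1) ≤ D n - α (n + 1) * (μ * W n) + β / 2 * (α (n + 1) * q * B) ^ 2
  drift (n : ℕ) : D n ≤ D (n + 1) + α (n + 1) * q * B ^ 2
  correlation_succ (n : ℕ) : A (n + 1) ≤ (1 - avgWeight) * Real.exp (t * (α (n + 1) * q * B ^ 2))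
    * (A n + α (n + 1) * B ^ 2) + avgWeight * D (n + 1)

namespace IsDescentSystem

variable {D A W α : ℕ → ℝ} {t μ β B q V : ℝ} {n K : ℕ}

theorem one_le (h : IsDescentSystem D A W α t μ β B q) (ht : 0 ≤ t) : 1 ≤ q :=
  (Real.one_le_exp (mul_nonneg ht (h.nonneg 0))).trans (h.exp_le 0)

/- Since `1 - avgWeight = 1 / (2e)`, the estimate keeps at most half of the old correlation as long
as the drift costs at most a factor `e`. -/
theorem correlation_sub_succ_le (h : IsDescentSystem D A W α t μ β B q) (ht : 0 ≤ t)
    (hα : 0 ≤ α (n + 1)) (hdrift : t * (α (n + 1) * q * B ^ 2) ≤ 1) :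
    A (n + 1) - 2 * D (n + 1) ≤ (A n - 2 * D n) / 2 + 3 / 2 * (α (n + 1) * q * B ^ 2) := by
  have hforget : (1 - avgWeight) * Real.exp (t * (α (n + 1) * q * B ^ 2)) ≤ 1 / 2 :=
    calc (1 - avgWeight) * Real.exp (t * (α (n + 1) * q * B ^ 2))
        = Real.exp (t * (α (n + 1) * q * B ^ 2)) / (2 * Real.exp 1) := by rw [avgWeight]; ring
      _ ≤ Real.exp 1 / (2 * Real.exp 1) := by gcongr
      _ = 1 / 2 := by field_simp
  have hlam : avgWeight ≤ 1 := sub_le_self _ (by positivity)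
  have hA : 0 ≤ A n + α (n + 1) * B ^ 2 := by have := h.correlation_nonneg n; positivity
  have hq : α (n + 1) * 1 * B ^ 2 ≤ α (n + 1) * q * B ^ 2 := by gcongr; exact h.one_le ht
  linarith [h.correlation_succ n, h.drift n, mul_le_mul_of_nonneg_right hforget hA,
    mul_le_mul_of_nonneg_right hlam (h.nonneg (n + 1))]

theorem correlation_le (h : IsDescentSystem D A W α t μ β B q) (ht : 0 ≤ t) (hμ : 0 < μ)
    (hα : ∀ k, 1 ≤ k → 0 ≤ α k) (hα_le : ∀ k, 1 ≤ k → α k ≤ 4 * Real.exp 1 / (μ * k)) {a : ℝ}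
    (ha : a = 4 * Real.exp 1 / (μ * (n + 1))) (hdrift : t * (2 * a * q * B ^ 2) ≤ 1) :
    A n ≤ 2 * D n + 7 * (a * q * B ^ 2) := by
  have hq := h.one_le ht
  have hα_le_two (j : ℕ) (hj : n / 2 ≤ j) : α (j + 1) ≤ 2 * a := by
    have hj' : (n : ℝ) + 1 ≤ 2 * (j + 1 : ℕ) := by exact_mod_cast (by omega)
    calc α (j + 1) ≤ 4 * Real.exp 1 / (μ * (j + 1 : ℕ)) := hα_le _ j.succ_pos
      _ = 2 * (4 * Real.exp 1 / (μ * (2 * (j + 1 : ℕ)))) := by field_simp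
      _ ≤ 2 * a := by rw [ha]; gcongr
  have ha_nonneg : 0 ≤ a := by rw [ha]; positivity
  have hhalf (i : ℕ) : A (n / 2 + (i + 1)) - 2 * D (n / 2 + (i + 1))
      ≤ (A (n / 2 + i) - 2 * D (n / 2 + i)) / 2 + 3 * (a * q * B ^ 2) := by
    have hαi : α (n / 2 + i + 1) * q * B ^ 2 ≤ 2 * a * q * B ^ 2 := by
      gcongr; exact hα_le_two _ (by omega)
    have := h.correlation_sub_succ_le ht (hα _ (n / 2 + i).succ_pos)
      ((mul_le_mul_of_nonneg_left hαi ht).trans hdrift)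
    rw [← add_assoc]
    linarith
  have hiter := le_pow_mul_add_of_succ_le_half
    (X := fun i => A (n / 2 + i) - 2 * D (n / 2 + i)) (by positivity) hhalf (n - n / 2)
  simp only [Nat.add_sub_cancel' (Nat.div_le_self n 2), add_zero] at hiter
  have hstart : (1 / 2) ^ (n - n / 2) * (A (n / 2) - 2 * D (n / 2)) ≤ a * q * B ^ 2 :=
    calc (1 / 2) ^ (n - n / 2) * (A (n / 2) - 2 * D (n / 2))
        ≤ (1 / 2) ^ (n - n / 2) * (q * (B ^ 2 / μ)) := by
          gcongr
          have := mul_le_mul_of_nonneg_left (h.le_sq_div (n / 2)) (by linarith : 0 ≤ q)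
          linarith [h.correlation_le_mul (n / 2), h.nonneg (n / 2)]
      _ ≤ 2 / (n + 1) * (q * (B ^ 2 / μ)) := by gcongr; exact one_half_pow_sub_half_le n
      _ ≤ 4 * Real.exp 1 / (n + 1) * (q * (B ^ 2 / μ)) := by
          gcongr; linarith [Real.add_one_le_exp (1 : ℝ)]
      _ = a * q * B ^ 2 := by rw [ha]; field_simp
  linarith

theorem six_mul_le (h : IsDescentSystem D A W α t μ β B q) (ht : 0 ≤ t) (hμ : 0 < μ)
    (hβ : μ ≤ 2 * β) (hV : 8 * β * B ^ 2 * (Real.exp 1 * q) ^ 2 / μ ^ 2 ≤ V) (n : ℕ) :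
    6 * D n ≤ V := by
  have he : 2 * 1 ≤ Real.exp 1 * q := by
    gcongr
    exacts [by linarith [Real.add_one_le_exp (1 : ℝ)], h.one_le ht]
  have hβ_nonneg : 0 ≤ β := by linarith
  calc 6 * D n ≤ 16 * (B ^ 2 / μ) := by linarith [h.le_sq_div n, h.nonneg n]
    _ = 4 * μ * B ^ 2 * (2 * 1) ^ 2 / μ ^ 2 := by field_simp; ring
    _ ≤ 4 * (2 * β) * B ^ 2 * (Real.exp 1 * q) ^ 2 / μ ^ 2 := by gcongr
    _ = 8 * β * B ^ 2 * (Real.exp 1 * q) ^ 2 / μ ^ 2 := by ring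
    _ ≤ V := hV

/- `exp (t D)` is at most `q`, so a drift of `1 / t` exceeds `D` by a factor that `q` controls. -/
theorem two_mul_le_of_large_drift (h : IsDescentSystem D A W α t μ β B q) (ht : 0 < t) {a : ℝ}
    (hdrift : 1 < t * (2 * a * q * B ^ 2)) : 2 * D n ≤ Real.exp 1 * q * (a * q * B ^ 2) := by
  have hq := h.one_le ht.le
  have hD : Real.exp 1 * (t * D n) ≤ q := Real.exp_one_mul_le_exp.trans (h.exp_le n)
  have he : (2 : ℝ) * 2 ≤ Real.exp 1 * Real.exp 1 := by
    gcongr <;> linarith [Real.add_one_le_exp (1 : ℝ)]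
  have htD : 0 ≤ t * D n := mul_nonneg ht.le (h.nonneg n)
  refine le_of_mul_le_mul_left ?_ (mul_pos two_pos ht)
  calc 2 * t * (2 * D n) = 2 * 2 * (t * D n) := by ring
    _ ≤ Real.exp 1 * Real.exp 1 * (t * D n) := by gcongr
    _ = Real.exp 1 * (Real.exp 1 * (t * D n)) := by ring
    _ ≤ Real.exp 1 * q * 1 := by rw [mul_one]; gcongr
    _ ≤ Real.exp 1 * q * (t * (2 * a * q * B ^ 2)) := by gcongr
    _ = 2 * t * (Real.exp 1 * q * (a * q * B ^ 2)) := by ring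

theorem succ_le_of_le_two_mul_exp_one (h : IsDescentSystem D A W α t μ β B q) (ht : 0 ≤ t)
    (hμ : 0 < μ) (hαn : α (n + 1) = 4 * Real.exp 1 / (μ * (n + 1)))
    (hV : 8 * β * B ^ 2 * (Real.exp 1 * q) ^ 2 / μ ^ 2 ≤ V) (hq : q ≤ 2 * Real.exp 1) :
    D (n + 1) ≤ (1 - 2 / (n + 1)) * D n + (2 - 1) * (V / (n + 1) ^ 2) := by
  have hαμ : α (n + 1) * μ = 4 * Real.exp 1 / (n + 1) := by rw [hαn]; field_simp
  have hdescent := h.descent n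
  rw [← mul_assoc, hαμ] at hdescent
  have hW : D n ≤ 2 * Real.exp 1 * W n := by
    have hW_nonneg : 0 ≤ W n := nonneg_of_mul_nonneg_right
      ((h.nonneg n).trans (h.le_mul_inv_correlation n)) (by linarith [h.one_le ht])
    exact (h.le_mul_inv_correlation n).trans (by gcongr)
  have hgain : 2 / (n + 1) * D n ≤ 4 * Real.exp 1 / (n + 1) * W n :=
    calc 2 / (n + 1) * D n ≤ 2 / (n + 1) * (2 * Real.exp 1 * W n) := by gcongr
      _ = 4 * Real.exp 1 / (n + 1) * W n := by ring
  linarith [noise_le hμ hαn hV]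

theorem succ_le_of_two_mul_exp_one_lt (h : IsDescentSystem D A W α t μ β B q) (ht : 0 ≤ t)
    (hμ : 0 < μ) (hβ : μ ≤ 2 * β) (hα : ∀ k, 1 ≤ k → 0 ≤ α k)
    (hα_le : ∀ k, 1 ≤ k → α k ≤ 4 * Real.exp 1 / (μ * k))
    (hαn : α (n + 1) = 4 * Real.exp 1 / (μ * (n + 1)))
    (hV : 8 * β * B ^ 2 * (Real.exp 1 * q) ^ 2 / μ ^ 2 ≤ V)
    (hdrift : t * (2 * α (n + 1) * q * B ^ 2) ≤ 1) (hq : 2 * Real.exp 1 < q) :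
    D (n + 1) ≤ (1 - 2 * Real.exp 1 / (n + 1)) * D n
      + (2 * Real.exp 1 - 1) * (V / (n + 1) ^ 2) := by
  have hαμ : α (n + 1) * μ = 4 * Real.exp 1 / (n + 1) := by rw [hαn]; field_simp
  have hdescent := h.descent n
  rw [← mul_assoc, hαμ] at hdescent
  have hW : D n / 2 - 7 / 4 * (α (n + 1) * q * B ^ 2) ≤ W n := by
    linarith [h.sub_le_inv_correlation n, h.correlation_le ht hμ hα hα_le hαn hdrift]
  have hgain := mul_le_mul_of_nonneg_left hW (by positivity : 0 ≤ 4 * Real.exp 1 / ((n : ℝ) + 1))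
  have he : 2 ≤ Real.exp 1 := by linarith [Real.add_one_le_exp (1 : ℝ)]
  have herror : 4 * Real.exp 1 / (n + 1) * (α (n + 1) * q * B ^ 2) ≤ V / (n + 1) ^ 2 :=
    calc 4 * Real.exp 1 / (n + 1) * (α (n + 1) * q * B ^ 2)
        ≤ q * Real.exp 1 / (n + 1) * (α (n + 1) * q * B ^ 2) := by
          have hα_nonneg : 0 ≤ α (n + 1) := hα _ n.succ_pos
          have hq_nonneg : 0 ≤ q := by linarith
          gcongr
          linarith
      _ = Real.exp 1 * q * (α (n + 1) * q * B ^ 2) / (n + 1) := by ring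
      _ ≤ V / (n + 1) / (n + 1) := by gcongr; exact drift_le hμ (by positivity) hβ hαn hV
      _ = V / (n + 1) ^ 2 := by rw [div_div, sq]
  have hV_nonneg := (mul_nonneg (by norm_num) (h.nonneg n)).trans (h.six_mul_le ht hμ hβ hV n)
  have hV_div_nonneg : 0 ≤ V / ((n : ℝ) + 1) ^ 2 := by positivity
  have hV_div := mul_le_mul_of_nonneg_right he hV_div_nonneg
  calc D (n + 1) ≤ D n - 4 * Real.exp 1 / (n + 1)
        * (D n / 2 - 7 / 4 * (α (n + 1) * q * B ^ 2)) + V / (n + 1) ^ 2 := by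
        linarith [noise_le hμ hαn hV]
    _ = (1 - 2 * Real.exp 1 / (n + 1)) * D n
        + (7 / 4 * (4 * Real.exp 1 / (n + 1) * (α (n + 1) * q * B ^ 2)) + V / (n + 1) ^ 2) := by
      ring
    _ ≤ (1 - 2 * Real.exp 1 / (n + 1)) * D n + (2 * Real.exp 1 - 1) * (V / (n + 1) ^ 2) := by
      gcongr
      linarith

theorem le_div_succ (h : IsDescentSystem D A W α t μ β B q) (ht : 0 < t) (hμ : 0 < μ)
    (hβ : μ ≤ 2 * β) (hα : ∀ k, 1 ≤ k → 0 ≤ α k)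
    (hα_le : ∀ k, 1 ≤ k → α k ≤ 4 * Real.exp 1 / (μ * k))
    (hαn : α (n + 1) = 4 * Real.exp 1 / (μ * (n + 1)))
    (hV : 8 * β * B ^ 2 * (Real.exp 1 * q) ^ 2 / μ ^ 2 ≤ V) (hD : D n ≤ V / (n + 1)) :
    D (n + 1) ≤ V / (n + 2) := by
  have hV_six := h.six_mul_le ht.le hμ hβ hV
  have hV_nonneg : 0 ≤ V := (mul_nonneg (by norm_num) (h.nonneg n)).trans (hV_six n)
  obtain hn | hn := lt_or_ge n 5
  · have hn' : (n : ℝ) + 2 ≤ 6 := by exact_mod_cast (by omega : n + 2 ≤ 6)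
    calc D (n + 1) ≤ V / 6 := by rw [le_div_iff₀' (by norm_num)]; exact hV_six _
      _ ≤ V / (n + 2) := by gcongr
  obtain hdrift | hdrift := lt_or_ge 1 (t * (2 * α (n + 1) * q * B ^ 2))
  · calc D (n + 1) ≤ V / (n + 1) / 2 := by
          rw [le_div_iff₀' two_pos]
          exact (h.two_mul_le_of_large_drift ht hdrift).trans
            (drift_le hμ (by positivity) hβ hαn hV)
      _ = V / (n + n + 2) := by rw [div_div]; ring_nf
      _ ≤ V / (n + 2) := by gcongr; simp
  have hk : (6 : ℝ) ≤ n + 1 := by exact_mod_cast (by omega : 6 ≤ n + 1)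
  rw [← one_add_one_eq_two, ← add_assoc]
  obtain hq | hq := le_or_gt q (2 * Real.exp 1)
  · exact le_div_succ_of_le (by positivity) (by linarith) hV_nonneg hD
      (h.succ_le_of_le_two_mul_exp_one ht.le hμ hαn hV hq)
  · exact le_div_succ_of_le (by positivity) (by linarith [Real.exp_one_lt_d9]) hV_nonneg hD
      (h.succ_le_of_two_mul_exp_one_lt ht.le hμ hβ hα hα_le hαn hV hdrift hq)

theorem le_div_add_one (h : IsDescentSystem D A W α t μ β B q) (ht : 0 < t) (hμ : 0 < μ)
    (hβ : μ ≤ 2 * β) (hα : ∀ k, 1 ≤ k → 0 ≤ α k)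
    (hα_le : ∀ k, 1 ≤ k → α k ≤ 4 * Real.exp 1 / (μ * k))
    (hαK : ∀ k, 1 ≤ k → K ≤ k → α k = 4 * Real.exp 1 / (μ * k))
    (hV : 8 * β * B ^ 2 * (Real.exp 1 * q) ^ 2 / μ ^ 2 ≤ V) (hVK : K * D (K - 1) ≤ V)
    {k : ℕ} (hk : K ≤ k) : D k ≤ V / (k + 1) := by
  have hstep (n : ℕ) (hn : K ≤ n + 1) (hD : D n ≤ V / (n + 1)) :
      D (n + 1) ≤ V / ((n + 1 : ℕ) + 1) := by
    rw [Nat.cast_succ, add_assoc, one_add_one_eq_two]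
    exact h.le_div_succ ht hμ hβ hα hα_le (by simpa using hαK _ n.succ_pos hn) hV hD
  induction k, hk using Nat.le_induction with
  | base =>
    cases K with
    | zero => simpa using (by linarith [h.six_mul_le ht.le hμ hβ hV 0, h.nonneg 0] : D 0 ≤ V)
    | succ n =>
      refine hstep n le_rfl ?_
      rw [le_div_iff₀' (by positivity)]
      exact_mod_cast hVK
  | succ k hk ih => exact hstep k (by omega) ih

end IsDescentSystem

end Recursion

section StepSize

variable {t μ L B Fmin Fmax : ℝ} {k : ℕ}

theorem avgWeight_mem_Icc : avgWeight ∈ Set.Icc (0 : ℝ) 1 := by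
  have he : 1 / (2 * Real.exp 1) ≤ 1 := by
    rw [div_le_one (by positivity)]
    linarith [Real.add_one_le_exp (1 : ℝ)]
  exact ⟨sub_nonneg.2 he, sub_le_self _ (by positivity)⟩

theorem stepSize_of_le (hk : burnIn t μ L B Fmin Fmax ≤ k) :
    stepSize t μ L B Fmin Fmax k = 4 * Real.exp 1 / (μ * k) :=
  if_neg hk.not_gt

theorem stepSize_nonneg (ht : 0 ≤ t) (hμ : 0 ≤ μ) (hL : 0 ≤ L) (hB : 0 ≤ B) :
    0 ≤ stepSize t μ L B Fmin Fmax k := by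
  rw [stepSize]
  split_ifs <;> positivity

theorem burnIn_le (ht : 0 ≤ t) (hμ : 0 < μ) (hL : 0 ≤ L) (hB : 0 ≤ B) :
    (burnIn t μ L B Fmin Fmax : ℝ)
      ≤ 4 * Real.exp 1 / μ * (t * L * B * Real.exp (t * (Fmax - Fmin)) + 1) := by
  rw [← Nat.le_floor_iff (by positivity), burnIn]
  refine csSup_le' fun k ⟨hk, hk_lt⟩ => Nat.le_floor (hk_lt.le.trans ?_)
  have hk' : (1 : ℝ) ≤ k := by exact_mod_cast hk
  calc 4 * Real.exp 1 / μ + 4 * Real.exp 1 * t * L * B * Real.exp (t * (Fmax - Fmin)) / (μ * k)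
      ≤ 4 * Real.exp 1 / μ
        + 4 * Real.exp 1 * t * L * B * Real.exp (t * (Fmax - Fmin)) / (μ * 1) := by gcongr
    _ = 4 * Real.exp 1 / μ * (t * L * B * Real.exp (t * (Fmax - Fmin)) + 1) := by ring

theorem stepSize_le (ht : 0 ≤ t) (hμ : 0 < μ) (hL : 0 ≤ L) (hB : 0 ≤ B) (hk : 1 ≤ k) :
    stepSize t μ L B Fmin Fmax k ≤ 4 * Real.exp 1 / (μ * k) := by
  obtain h | h := lt_or_ge k (burnIn t μ L B Fmin Fmax)
  · have hk' : (0 : ℝ) < k := by exact_mod_cast hk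
    rw [stepSize, if_pos h, one_div, inv_le_iff_one_le_mul₀ (by positivity)]
    calc 1 = (k : ℝ) / k := (div_self hk'.ne').symm
      _ ≤ 4 * Real.exp 1 / μ * (t * L * B * Real.exp (t * (Fmax - Fmin)) + 1) / k := by
        gcongr
        exact (Nat.cast_le.2 h.le).trans (burnIn_le ht hμ hL hB)
      _ = 4 * Real.exp 1 / (μ * k) * (t * L * B * Real.exp (t * (Fmax - Fmin)) + 1) := by
        field_simp
  · exact (stepSize_of_le h).le

end StepSize

section RunExpectation

variable {Ω : Type*} [MeasurableSpace Ω] {P : Measure Ω} {d N : ℕ}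
  {f : Fin N → EuclideanSpace ℝ (Fin d) → ℝ} {t lam m Fmin Fmax : ℝ} {α : ℕ → ℝ}
  {Θ : Set (EuclideanSpace ℝ (Fin d))} {s : ℕ → Ω → EuclideanSpace ℝ (Fin d) × ℝ}
  {i j : ℕ → Ω → Fin N}

theorem ae_estimate_mem_Icc (ht : 0 < t) (hlam : lam ∈ Set.Icc (0 : ℝ) 1)
    (hf_mem : ∀ i, ∀ θ ∈ Θ, f i θ ∈ Set.Icc Fmin Fmax)
    (hs : ∀ n ω, s (n + 1) ω = step f t lam (α (n + 1)) (i (n + 1) ω) (j (n + 1) ω) (s n ω))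
    (hs₀ : ∀ᵐ ω ∂P, (s 0 ω).2 ∈ Set.Icc Fmin Fmax) (hsΘ : ∀ n, ∀ᵐ ω ∂P, (s n ω).1 ∈ Θ) (n : ℕ) :
    ∀ᵐ ω ∂P, (s n ω).2 ∈ Set.Icc Fmin Fmax := by
  induction n with
  | zero => exact hs₀
  | succ n ih =>
    filter_upwards [ih, hsΘ n] with ω hω hωΘ
    rw [hs, step_snd]
    exact newEstimate_mem_Icc ht hlam hω (hf_mem _ _ hωΘ)

variable [NeZero N]

theorem ae_estimateRatio_mem_Icc (ht : 0 < t) (hlam : lam ∈ Set.Icc (0 : ℝ) 1)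
    (hf_mem : ∀ i, ∀ θ ∈ Θ, f i θ ∈ Set.Icc Fmin Fmax)
    (hs : ∀ n ω, s (n + 1) ω = step f t lam (α (n + 1)) (i (n + 1) ω) (j (n + 1) ω) (s n ω))
    (hs₀ : ∀ᵐ ω ∂P, (s 0 ω).2 ∈ Set.Icc Fmin Fmax) (hsΘ : ∀ n, ∀ᵐ ω ∂P, (s n ω).1 ∈ Θ) (n : ℕ) :
    ∀ᵐ ω ∂P, estimateRatio f t lam (j (n + 1) ω) (s n ω)
      ∈ Set.Icc (Real.exp (t * (Fmax - Fmin)))⁻¹ (Real.exp (t * (Fmax - Fmin))) := by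
  filter_upwards [ae_estimate_mem_Icc ht hlam hf_mem hs hs₀ hsΘ n, hsΘ n] with ω hω hωΘ
  exact estimateRatio_mem_Icc ht hlam hω fun i => hf_mem i _ hωΘ

theorem isDescentSystem_of_isFreshPair [IsProbabilityMeasure P] {μ B : ℝ} {β : ℝ≥0} (ht : 0 < t)
    (hμ : 0 < μ) (hΘ : IsOpen Θ) (hα : ∀ k, 1 ≤ k → 0 ≤ α k)
    (hf : ∀ i, DifferentiableOn ℝ (f i) Θ) (hf_mem : ∀ i, ∀ θ ∈ Θ, f i θ ∈ Set.Icc Fmin Fmax)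
    (hR : IsSmoothOn β (tiltedRisk f t) Θ) (hB : ∀ i, ∀ θ ∈ Θ, ‖tiltedStochGrad f t i θ‖ ≤ B)
    (hPL : ∀ θ ∈ Θ, μ * (tiltedRisk f t θ - m) ≤ ‖gradient (tiltedRisk f t) θ‖ ^ 2)
    (hm_ge : Fmin ≤ m) (hm : ∀ θ ∈ Θ, m ≤ tiltedRisk f t θ)
    (hs : ∀ n ω, s (n + 1) ω = step f t avgWeight (α (n + 1)) (i (n + 1) ω) (j (n + 1) ω) (s n ω))
    (hs₀ : ∀ᵐ ω ∂P, (s 0 ω).2 ∈ Set.Icc Fmin Fmax)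
    (hfresh : ∀ n, IsFreshPair P (s n) (i (n + 1)) (j (n + 1)))
    (hstay : ∀ n, ∀ᵐ ω ∂P, segment ℝ (s n ω).1 (s (n + 1) ω).1 ⊆ Θ) :
    IsDescentSystem (fun n => ∫ ω, (tiltedRisk f t (s n ω).1 - m) ∂P)
      (fun n => ∫ ω, estimateRatio f t avgWeight (j (n + 1) ω) (s n ω)
        * (tiltedRisk f t (s n ω).1 - m) ∂P)
      (fun n => ∫ ω, (estimateRatio f t avgWeight (j (n + 1) ω) (s n ω))⁻¹
        * (tiltedRisk f t (s n ω).1 - m) ∂P)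
      α t μ β B (Real.exp (t * (Fmax - Fmin))) := by
  have hsΘ (n : ℕ) : ∀ᵐ ω ∂P, (s n ω).1 ∈ Θ :=
    (hstay n).mono fun ω hω => hω (left_mem_segment ℝ _ _)
  have hsm (n : ℕ) : ∀ᵐ ω ∂P, m ≤ tiltedRisk f t (s n ω).1 := (hsΘ n).mono fun ω hω => hm _ hω
  have hratio := ae_estimateRatio_mem_Icc ht avgWeight_mem_Icc hf_mem hs hs₀ hsΘ
  have hratio_le (n : ℕ) := (hratio n).mono fun ω hω => hω.2
  have hinv_le (n : ℕ) : ∀ᵐ ω ∂P, (estimateRatio f t avgWeight (j (n + 1) ω) (s n ω))⁻¹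
      ≤ Real.exp (t * (Fmax - Fmin)) :=
    (hratio n).mono fun ω hω => inv_le_of_inv_le₀ (Real.exp_pos _) hω.1
  have hnorm : ∀ θ ∈ Θ, ‖gradient (tiltedRisk f t) θ‖ ≤ B := fun θ hθ =>
    norm_gradient_tiltedRisk_le ht.ne' (fun i => (hf i).differentiableAt (hΘ.mem_nhds hθ))
      fun i => hB i θ hθ
  have hfresh' (n : ℕ) := funext (hs n) ▸ hfresh (n + 1)
  simp only [hs] at hstay
  exact {
    nonneg n := integral_nonneg_of_ae <| (hsm n).mono fun ω hω => sub_nonneg.2 hω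
    correlation_nonneg n := integral_nonneg_of_ae <| (hsm n).mono fun ω hω =>
      mul_nonneg estimateRatio_pos.le (sub_nonneg.2 hω)
    le_sq_div n := integral_tiltedRisk_sub_le (hfresh n) <| (hsΘ n).mono fun ω hω =>
      (le_div_iff₀' hμ).2 ((hPL _ hω).trans (pow_le_pow_left₀ (norm_nonneg _) (hnorm _ hω) 2))
    exp_le n := by
      gcongr
      exact integral_tiltedRisk_sub_le (hfresh n) <| (hsΘ n).mono fun ω hω =>
        sub_le_sub (tiltedRisk_mem_Icc ht fun i => hf_mem i _ hω).2 hm_ge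
    le_mul_inv_correlation n :=
      integral_le_mul_integral_inv_estimateRatio_mul (hfresh n) (hsm n) (hratio_le n)
    sub_le_inv_correlation n := integral_sub_le_integral_inv_estimateRatio_mul (hfresh n) (hsm n)
    correlation_le_mul n :=
      integral_estimateRatio_mul_le_mul_integral (hfresh n) (hsm n) (hratio_le n)
    descent n := by
      simpa only [hs] using integral_tiltedRisk_step_le (hfresh n) hΘ ht.ne' (hα _ n.succ_pos) hf hR
        hB hPL (hstay n) (hinv_le n)
    drift n := by
      simpa only [hs] using integral_tiltedRisk_le_integral_step (hfresh n) hΘ ht.ne'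
        (hα _ n.succ_pos) hf hB (hstay n) (hinv_le n)
    correlation_succ n := by
      simpa only [hs] using integral_estimateRatio_step_mul_le (hfresh n) (hfresh' n) hΘ ht
        avgWeight_mem_Icc (hα _ n.succ_pos) hf hB hm (hstay n) (hinv_le n) }

end RunExpectation

end TERM

theorem mainTheorem11_general {Ω : Type*} [MeasurableSpace Ω] (P : Measure Ω)
    [IsProbabilityMeasure P] {d N : ℕ} (f : Fin N → EuclideanSpace ℝ (Fin d) → ℝ)
    (Θ : Set (EuclideanSpace ℝ (Fin d))) (t μ B Fmin Fmax : ℝ) (β : ℝ≥0) (α : ℕ → ℝ) (K : ℕ)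
    (θ₁ θopt : EuclideanSpace ℝ (Fin d)) (ζ ξ : ℕ → Ω → Fin N) (ht : 0 < t) (hμ : 0 < μ)
    (hα : ∀ k, 1 ≤ k → 0 ≤ α k) (hα_le : ∀ k, 1 ≤ k → α k ≤ 4 * Real.exp 1 / (μ * k))
    (hαK : ∀ k, 1 ≤ k → K ≤ k → α k = 4 * Real.exp 1 / (μ * k))
    (hΘ_open : IsOpen Θ) (hΘ_conn : IsPreconnected Θ)
    (hf_diff : ∀ i, DifferentiableOn ℝ (f i) Θ)
    (hf_mem : ∀ i, ∀ θ ∈ Θ, f i θ ∈ Set.Icc Fmin Fmax)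
    (hR_smooth : TERM.IsSmoothOn β (TERM.tiltedRisk f t) Θ)
    (hR_grad : ∀ i, ∀ θ ∈ Θ, ‖TERM.tiltedStochGrad f t i θ‖ ≤ B)
    (hPL : ∀ p ∈ stdSimplex ℝ (Fin N), TERM.IsPLOn (μ / 2) (fun θ => ∑ i, p i * f i θ) Θ)
    (hopt_mem : θopt ∈ Θ) (hopt : IsMinOn (TERM.tiltedRisk f t) Θ θopt)
    (hζ_meas : ∀ k, Measurable (ζ k)) (hξ_meas : ∀ k, Measurable (ξ k))
    (hindep : iIndepFun (Sum.elim ζ ξ) P)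
    (hζ_unif : ∀ k i, P.real (ζ k ⁻¹' {i}) = 1 / (N : ℝ))
    (hξ_unif : ∀ k i, P.real (ξ k ⁻¹' {i}) = 1 / (N : ℝ))
    (hstay : ∀ k, ∀ᵐ ω ∂P, segment ℝ
      (TERM.iterate f t TERM.avgWeight α θ₁ (fun n => ζ n ω) (fun n => ξ n ω) k)
      (TERM.iterate f t TERM.avgWeight α θ₁ (fun n => ζ n ω) (fun n => ξ n ω) (k + 1)) ⊆ Θ) :
    (∀ k, Integrable (fun ω => TERM.tiltedRisk f t
        (TERM.iterate f t TERM.avgWeight α θ₁ (fun n => ζ n ω) (fun n => ξ n ω) k)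
          - TERM.tiltedRisk f t θopt) P) ∧
    ∀ k, K ≤ k →
      ∫ ω, (TERM.tiltedRisk f t
          (TERM.iterate f t TERM.avgWeight α θ₁ (fun n => ζ n ω) (fun n => ξ n ω) (k + 1))
          - TERM.tiltedRisk f t θopt) ∂P
        ≤ max ((K : ℝ) * ∫ ω, (TERM.tiltedRisk f t
              (TERM.iterate f t TERM.avgWeight α θ₁ (fun n => ζ n ω) (fun n => ξ n ω) K)
              - TERM.tiltedRisk f t θopt) ∂P)
            (8 * β * B ^ 2 * Real.exp (2 * t * (Fmax - Fmin) + 2) / μ ^ 2)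
          / ((k : ℝ) + 1) := by
  obtain ⟨ω₀⟩ := P.nonempty_of_neZero
  have : NeZero N := ⟨(ζ 0 ω₀).pos.ne'⟩
  have hfresh := TERM.isFreshPair_run (f := f) (t := t) (lam := TERM.avgWeight) (α := α)
    (θ₁ := θ₁) hζ_meas hξ_meas hindep hζ_unif hξ_unif
  refine ⟨fun k => (hfresh (k - 1)).integrable fun s _ _ =>
    TERM.tiltedRisk f t s.1 - TERM.tiltedRisk f t θopt, fun k hk => ?_⟩
  have hR_PL : ∀ θ ∈ Θ, μ * (TERM.tiltedRisk f t θ - TERM.tiltedRisk f t θopt)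
      ≤ ‖gradient (TERM.tiltedRisk f t) θ‖ ^ 2 := fun θ hθ =>
    TERM.tiltedRisk_PL ht hμ.le hθ hopt_mem
      (fun i => (hf_diff i).differentiableAt (hΘ_open.mem_nhds hθ)) hPL
  obtain hβ | hβ := lt_or_ge (2 * (β : ℝ)) μ
  · have hgap : ∫ ω, (TERM.tiltedRisk f t
        (TERM.iterate f t TERM.avgWeight α θ₁ (fun n => ζ n ω) (fun n => ξ n ω) (k + 1))
        - TERM.tiltedRisk f t θopt) ∂P = 0 := by
      refine integral_eq_zero_of_ae ((hstay (k + 1)).mono fun ω hω => sub_eq_zero.2 ?_)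
      exact TERM.eq_of_lipschitz_gradient_lt_PL hΘ_open hΘ_conn hR_smooth.1 hR_smooth.2 hopt_mem
        hopt hβ hR_PL (hω (left_mem_segment ℝ _ _))
    rw [hgap]
    positivity
  · have hsystem := TERM.isDescentSystem_of_isFreshPair ht hμ hΘ_open hα hf_diff hf_mem hR_smooth
      hR_grad hR_PL (TERM.tiltedRisk_mem_Icc ht fun i => hf_mem i _ hopt_mem).1
      (fun _ hθ => hopt hθ) (fun _ _ => rfl) (by
        filter_upwards [hstay 0] with ω hω
        exact TERM.tiltedRisk_mem_Icc ht fun i => hf_mem i _ (hω (left_mem_segment ℝ _ _)))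
      hfresh fun n => hstay (n + 1)
    refine hsystem.le_div_add_one ht hμ hβ hα hα_le hαK (le_max_of_le_right (le_of_eq ?_))
      (le_max_left _ _) hk
    rw [← Real.exp_add, ← Real.exp_nat_mul]
    ring_nf

theorem mainTheorem11 {Ω : Type*} [MeasurableSpace Ω] (P : Measure Ω) [IsProbabilityMeasure P]
    {d N : ℕ} (hN : 0 < N)
    (f : Fin N → EuclideanSpace ℝ (Fin d) → ℝ) (Θ : Set (EuclideanSpace ℝ (Fin d)))
    (t μ B Fmin Fmax : ℝ) (L β : ℝ≥0) (θ₁ θopt : EuclideanSpace ℝ (Fin d))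
    (ζ ξ : ℕ → Ω → Fin N)
    (ht : 0 < t) (hμ : 0 < μ)
    -- the parameter domain
    (hΘ_open : IsOpen Θ) (hΘ_conn : IsConnected Θ)
    -- the losses: differentiable, bounded and `L`-Lipschitz on `Θ`
    (hf_diff : ∀ i, DifferentiableOn ℝ (f i) Θ)
    (hf_bdd : ∀ i, ∀ θ ∈ Θ, Fmin ≤ f i θ ∧ f i θ ≤ Fmax)
    (hf_lip : ∀ i, LipschitzOnWith L (f i) Θ)
    -- the tilted risk: `β`-smooth, with bounded stochastic gradients
    (hR_smooth : TERM.IsSmoothOn β (TERM.tiltedRisk f t) Θ)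
    (hR_grad : ∀ i, ∀ θ ∈ Θ, ‖TERM.tiltedStochGrad f t i θ‖ ≤ B)
    -- every convex combination of the losses is `μ/2`-PL
    (hPL : ∀ p ∈ stdSimplex ℝ (Fin N), TERM.IsPLOn (μ / 2) (fun θ => ∑ i, p i * f i θ) Θ)
    -- a `t`-tilted solution
    (hopt_mem : θopt ∈ Θ) (hopt : IsMinOn (TERM.tiltedRisk f t) Θ θopt)
    -- the samples: independent and uniform on `{0, …, N-1}`
    (hζ_meas : ∀ k, Measurable (ζ k)) (hξ_meas : ∀ k, Measurable (ξ k))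
    (hindep : iIndepFun (Sum.elim ζ ξ) P)
    (hζ_unif : ∀ k i, P.real (ζ k ⁻¹' {i}) = 1 / (N : ℝ))
    (hξ_unif : ∀ k i, P.real (ξ k ⁻¹' {i}) = 1 / (N : ℝ))
    -- the run starts in `Θ` and stays there
    (hθ₁ : θ₁ ∈ Θ)
    (hstay : ∀ k, ∀ᵐ ω ∂P, segment ℝ (TERM.solver f t μ L B Fmin Fmax θ₁ ζ ξ k ω)
      (TERM.solver f t μ L B Fmin Fmax θ₁ ζ ξ (k + 1) ω) ⊆ Θ) :
    (∀ k, Integrable (fun ω => TERM.tiltedRisk f t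
        (TERM.solver f t μ L B Fmin Fmax θ₁ ζ ξ k ω) - TERM.tiltedRisk f t θopt) P) ∧
    ∀ k, TERM.burnIn t μ L B Fmin Fmax ≤ k →
      ∫ ω, (TERM.tiltedRisk f t (TERM.solver f t μ L B Fmin Fmax θ₁ ζ ξ (k + 1) ω)
          - TERM.tiltedRisk f t θopt) ∂P
        ≤ max ((TERM.burnIn t μ L B Fmin Fmax : ℝ) *
              ∫ ω, (TERM.tiltedRisk f t (TERM.solver f t μ L B Fmin Fmax θ₁ ζ ξ
                (TERM.burnIn t μ L B Fmin Fmax) ω) - TERM.tiltedRisk f t θopt) ∂P)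
            (8 * β * B ^ 2 * Real.exp (2 * t * (Fmax - Fmin) + 2) / μ ^ 2)
          / ((k : ℝ) + 1) := by
  have hB : 0 ≤ B := (norm_nonneg _).trans (hR_grad ⟨0, hN⟩ θ₁ hθ₁)
  exact mainTheorem11_general P f Θ t μ B Fmin Fmax β (TERM.stepSize t μ L B Fmin Fmax)
    (TERM.burnIn t μ L B Fmin Fmax) θ₁ θopt ζ ξ ht hμ
    (fun _ _ => TERM.stepSize_nonneg ht.le hμ.le L.2 hB)
    (fun _ => TERM.stepSize_le ht.le hμ L.2 hB) (fun _ _ => TERM.stepSize_of_le)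
    hΘ_open hΘ_conn.isPreconnected hf_diff hf_bdd hR_smooth hR_grad hPL hopt_mem hopt
    hζ_meas hξ_meas hindep hζ_unif hξ_unif hstay
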